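/- Let $\Delta\ge 2$, $N\ge 1$, and let $E$ be a (deterministic) set of subsets of $[N]=\{1,\dots,N\}$, called hyperedges, each with an even number $p$ of vertices, $2\le p\le\Delta$; let $E_p$ be the set of hyperedges with $p$ vertices. For each $2\le p\le \Delta$ let $\rho_p:\mathbb R\to\mathbb R$ be odd and measurable. For $J=(J_e)_{e\in E}\in\mathbb R^E$ and $\sigma\in\{\pm1\}^N$ let $$H_J(\sigma)=\sum_{2\le p\le\Delta}\ \sum_{e\in E_p}\rho_p(J_e)\prod_{i\in e}\sigma_i .$$ For $\beta\in[0,\infty)$ let $G_{J,\beta}(\sigma)=e^{\beta H_J(\sigma)}/\sum_{\sigma'}e^{\beta H_J(\sigma')}$, and let $G_{J,\infty}$ be the uniform distribution on the set of maximizers of $H_J$. Let $J_e,J_e'$ ($e\in E$) be independent standard Gaussian variables. For $t\ge 0$ let $J(t)$ be either the continuous perturbation $J_e(t)=e^{-t}J_e+\sqrt{1-e^{-2t}}\,J_e'$, or the discrete perturbation $J_e(t)=B_eJ_e+(1-B_e)J_e'$, where the $B_e$ are Bernoulli variables with $P(B_e=1)=e^{-t}$, $P(B_e=0)=1-e^{-t}$,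 independent of each other and of $J,J'$. Let $R(\sigma,\tau)=\frac1N\sum_{i=1}^N\sigma_i\tau_i$, let $\langle\cdot\rangle_t$ be the average over $(\sigma,\tau)\sim G_{J,\beta}\otimes G_{J(t),\beta}$, and let $\mathbb E$ be the expectation over all the disorder. For $x\neq y$ in $[N]$ let $d(x,y)$ be the minimal $\ell$ for which there are distinct vertices $x=v_1,\dots,v_{\ell+1}=y$ and distinct hyperedges $e_1,\dots,e_\ell\in E$ with $\{v_k,v_{k+1}\}\subseteq e_k$ for all $k$ ($d(x,y)=\infty$ if there are none); let $d(x,x)=0$ and $B_r(x)=\{y\in[N]: d(x,y)\le r\}$. Then for both types of perturbation, all $t\ge 0$, all $\beta\in[0,\infty]$ and all integers $r\ge 0$, $$\mathbb E\langle R(\sigma,\tau)^2\rangle_t\le \frac1N\max_{i\in[N]}|B_r(i)|+e^{-tr}.$$ Moreover: 1. For all $A,\theta>0$ there is a constant $C>0$ depending only on $A$ and $\theta$ such that, whenever $\max_i|B_r(i)|\le A r^\theta$ for all integers $r\ge1$, then for both types of perturbation, all $t>0$ and all $\beta\in[0,\infty]$, $$\mathbb E\langle R(\sigma,\tau)^2\rangle_t\le\frac1N+\frac{C}{N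 t^\theta}.$$ 2. For all $A$ and $\gamma>1$ there is a constant $C>0$ depending only on $A$ and $\gamma$ such that, whenever $\max_i|B_r(i)|\le A\gamma^r$ for all integers $r\ge1$, then for both types of perturbation, all $t>0$ and all $\beta\in[0,\infty]$, $$\mathbb E\langle R(\sigma,\tau)^2\rangle_t\le\frac{C}{N^{t/(t+\log\gamma)}} .$$ -/

import Mathlib

open MeasureTheory ProbabilityTheory
open scoped NNReal ENNReal

noncomputable section

/-! Hypergraphs on the vertex set `Fin N`, given by a finite family `E` of hyperedges
(each hyperedge is the finite set of its vertices). -/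

/-- `v` and `e` form a Berge path of length `ℓ` between `x` and `y`: the `ℓ + 1` vertices
`v 0, …, v ℓ` are distinct, the `ℓ` hyperedges `e 0, …, e (ℓ - 1)` are distinct,
and `e k` contains both `v k` and `v (k + 1)`. -/
structure IsBergePath {N : ℕ} (E : Finset (Finset (Fin N))) (x y : Fin N) (ℓ : ℕ)
    (v : Fin (ℓ + 1) → Fin N) (e : Fin ℓ → Finset (Fin N)) : Prop where
  start : v 0 = x
  finish : v (Fin.last ℓ) = y
  vertices_distinct : Function.Injective v
  edges_distinct : Function.Injective e
  edges_mem : ∀ k, e k ∈ E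
  incident : ∀ k : Fin ℓ, v k.castSucc ∈ e k ∧ v k.succ ∈ e k

/-- Hypergraph distance: `0` if `x = y`, otherwise the minimal length of a Berge path
between `x` and `y`, and `⊤` if there is none. -/
def hypergraphDist {N : ℕ} (E : Finset (Finset (Fin N))) (x y : Fin N) : ℕ∞ :=
  if x = y then 0
  else ⨅ (ℓ : ℕ) (_ : ∃ v e, IsBergePath E x y ℓ v e), (ℓ : ℕ∞)

open Classical in
/-- The closed ball `B_r(x)`. -/
def hypergraphBall {N : ℕ} (E : Finset (Finset (Fin N))) (r : ℕ) (x : Fin N) :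
    Finset (Fin N) :=
  Finset.univ.filter fun y => hypergraphDist E x y ≤ (r : ℕ∞)

/-- `max_{i ∈ [N]} |B_r(i)|`. -/
def maxBallCard {N : ℕ} (E : Finset (Finset (Fin N))) (r : ℕ) : ℕ :=
  Finset.univ.sup fun i => (hypergraphBall E r i).card

/-- The data of a mixed even `p`-spin short-range model on `N` sites: the hyperedges, each with
an even number `p` of vertices, `2 ≤ p ≤ Δ`, and for each `2 ≤ p ≤ Δ` the odd measurable function
`ρ p` such that `ρ p (J_e)` is the disorder at a hyperedge `e` with `p` vertices. -/
structure MixedEvenModel (N Δ : ℕ) where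
  edges : Finset (Finset (Fin N))
  two_le_card : ∀ e ∈ edges, 2 ≤ e.card
  card_le : ∀ e ∈ edges, e.card ≤ Δ
  even_card : ∀ e ∈ edges, Even e.card
  ρ : ℕ → ℝ → ℝ
  measurable_ρ : ∀ p, 2 ≤ p → p ≤ Δ → Measurable (ρ p)
  odd_ρ : ∀ p, 2 ≤ p → p ≤ Δ → Function.Odd (ρ p)

/-- Spin configurations `{±1}^N`. -/
abbrev SpinConfig (N : ℕ) : Type := Fin N → ℤˣ

/-- The value `±1` of the spin at site `i`, as a real number. -/
def spin {N : ℕ} (σ : SpinConfig N) (i : Fin N) : ℝ := ((σ i : ℤ) : ℝ)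

/-- The overlap `R(σ, τ) = (1/N) ∑ᵢ σᵢ τᵢ`. -/
def overlap {N : ℕ} (σ τ : SpinConfig N) : ℝ := (1 / (N : ℝ)) * ∑ i, spin σ i * spin τ i

/-- Gibbs weight of `σ` for the Hamiltonian `H` at inverse temperature `β ∈ [0, ∞]`:
`exp (β H(σ))` for `β < ∞`, and the indicator that `σ` is a ground state (a maximizer
of `H`) for `β = ∞`. -/
def gibbsWeight {N : ℕ} (H : SpinConfig N → ℝ) (β : ℝ≥0∞) (σ : SpinConfig N) : ℝ :=
  open Classical in
  if β = ⊤ then (if ∀ τ, H τ ≤ H σ then 1 else 0) else Real.exp (β.toReal * H σ)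

/-- The Gibbs measure, as a probability mass function: the normalized Gibbs weight.
For `β = ∞` it is uniform on the set of ground states. -/
def gibbs {N : ℕ} (H : SpinConfig N → ℝ) (β : ℝ≥0∞) (σ : SpinConfig N) : ℝ :=
  gibbsWeight H β σ / ∑ τ, gibbsWeight H β τ

/-- The two types of perturbation of the disorder. -/
inductive Perturbation
  | continuous
  | discrete

/-- `e^{-t}` as an element of the unit interval. -/
def keepProb (t : ℝ≥0) : unitInterval :=
  ⟨Real.exp (-(t : ℝ)), (Real.exp_pos _).le, Real.exp_le_one_iff.2 (neg_nonpos.2 t.coe_nonneg)⟩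

namespace MixedEvenModel

variable {N Δ : ℕ} (M : MixedEvenModel N Δ)

/-- Disorder configurations `(J_e)`, indexed by the hyperedges. -/
abbrev Disorder : Type := {e // e ∈ M.edges} → ℝ

/-- `H_J(σ) = ∑_{2 ≤ p ≤ Δ} ∑_{e ∈ E_p} ρ_p(J_e) σ_e`, where `σ_e = ∏_{i ∈ e} σ_i`; the double sum
is written as one sum over all hyperedges `e`, with `p` the number of vertices of `e`. -/
def hamiltonian (J : M.Disorder) (σ : SpinConfig N) : ℝ :=
  ∑ e, M.ρ e.1.card (J e) * ∏ i ∈ e.1, spin σ i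

/-- The joint law of `(J, J', B)`: the `J_e` and `J'_e` are standard Gaussian, the `B_e` are
Bernoulli with values in `{0, 1}` and `P(B_e = 1) = e^{-t}`, and all of them are independent. -/
def noiseLaw (t : ℝ≥0) : Measure (M.Disorder × M.Disorder × M.Disorder) :=
  (Measure.pi fun _ => gaussianReal 0 1).prod
    ((Measure.pi fun _ => gaussianReal 0 1).prod
      (Measure.pi fun _ => bernoulliMeasure (1 : ℝ) 0 (keepProb t)))

/-- The perturbed disorder `J(t)`: `e^{-t} J + √(1 - e^{-2t}) J'` for the continuous perturbation,
`B J + (1 - B) J'` for the discrete one (coordinatewise). -/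
def perturbed (P : Perturbation) (t : ℝ≥0) (ω : M.Disorder × M.Disorder × M.Disorder) :
    M.Disorder := fun e =>
  match P with
  | .continuous =>
      Real.exp (-(t : ℝ)) * ω.1 e + Real.sqrt (1 - Real.exp (-2 * (t : ℝ))) * ω.2.1 e
  | .discrete => ω.2.2 e * ω.1 e + (1 - ω.2.2 e) * ω.2.1 e

/-- The average of `R(σ, τ)²` when `(σ, τ)` has law `G_J ⊗ G_{J₂}` at inverse temperature `β`. -/
def overlapSqAvg (β : ℝ≥0∞) (J J₂ : M.Disorder) : ℝ :=
  ∑ σ, ∑ τ, gibbs (M.hamiltonian J) β σ * gibbs (M.hamiltonian J₂) β τ * overlap σ τ ^ 2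

/-- `⟨R(σ, τ)²⟩_t` as a random variable. -/
def overlapSqAt (P : Perturbation) (β : ℝ≥0∞) (t : ℝ≥0)
    (ω : M.Disorder × M.Disorder × M.Disorder) : ℝ :=
  M.overlapSqAvg β ω.1 (M.perturbed P t ω)

/-- `E ⟨R(σ, τ)²⟩_t`. -/
def expectedOverlapSq (P : Perturbation) (β : ℝ≥0∞) (t : ℝ≥0) : ℝ :=
  ∫ ω, M.overlapSqAt P β t ω ∂(M.noiseLaw t)

end MixedEvenModel

end

/-! ### Correlations of a function of independent coordinates under noise -/

section Correlation

variable {ι X Y Z : Type*} [Fintype ι] [MeasurableSpace X] [MeasurableSpace Y] [MeasurableSpace Z]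

/-! Expanding the square, `overlapSqAvg_eq` and `expectedOverlapSq_eq` write the quantity as the
average over pairs i, j of E f(J) f(J(t)), where f(J) = ⟨σᵢσⱼ⟩ is a two-point function with |f| ≤ 1.
The core is that this correlation is at most e^{-t(r+1)} when j lies outside the ball of radius r
about i.

The reason is gauge symmetry. At most r hyperedges cannot connect i to j, so some vertex set V
contains i but not j and is cut by none of them (`exists_separating`). Flipping the spins in V is
equivalent to flipping the couplings of hyperedges that meet V in an odd number of sites. Since
hyperedges have even size, the r given ones are not flipped, while f changes sign
(`exists_flip_twoPoint`). Hence f has zero conditional mean given any r couplings: it has no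
components depending on at most r coordinates.

Decay at rate d = r + 1 (`correlation_pairLaw_le`) is obtained without an orthogonal expansion. Let
φ(t) = E f(J) f(J(t)). For large t, writing each one-coordinate law as an independent part plus a
part of mass O(e^{-t}) and expanding the product kills all terms with fewer than d small factors, so
φ(t) ≤ C e^{-dt} with a poor constant C. Reversibility and the semigroup property give φ(t)² ≤
φ(2t), and iterating this removes C.

The growth estimates follow by summing over distances: by telescoping over shells for polynomial
growth, and by choosing r to balance the two terms for exponential growth. -/

theorem integral_pi_prod (α : Measure X) (β : Measure Y) [IsProbabilityMeasure α]
    [IsProbabilityMeasure β] (G : (ι → X) × (ι → Y) → ℝ) :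
    ∫ z, G (fun e => (z e).1, fun e => (z e).2) ∂Measure.pi (fun _ : ι => α.prod β)
      = ∫ p, G p ∂(Measure.pi fun _ : ι => α).prod (Measure.pi fun _ : ι => β) :=
  (measurePreserving_arrowProdEquivProdArrow X Y ι (fun _ => α) (fun _ => β)).integral_comp' G

theorem sq_integral_le_integral_sq (μ : Measure X) [IsProbabilityMeasure μ] {h : X → ℝ}
    (hm : Measurable h) (hb : ∀ x, |h x| ≤ 1) : (∫ x, h x ∂μ) ^ 2 ≤ ∫ x, h x ^ 2 ∂μ := by
  have hi : Integrable h μ := .of_bound hm.aestronglyMeasurable 1 (ae_of_all _ hb)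
  have hi2 : Integrable (fun x => h x ^ 2) μ :=
    .of_bound (hm.pow_const 2).aestronglyMeasurable 1 (ae_of_all _ fun x => by
      rw [Real.norm_eq_abs, abs_of_nonneg (sq_nonneg _), sq_le_one_iff_abs_le_one]; exact hb x)
  set m := ∫ x, h x ∂μ with hmdef
  have h0 : 0 ≤ ∫ x, (h x - m) ^ 2 ∂μ := integral_nonneg fun x => sq_nonneg _
  have h1 : ∫ x, (h x - m) ^ 2 ∂μ = ∫ x, h x ^ 2 ∂μ - m ^ 2 := by
    have : ∀ x, (h x - m) ^ 2 = h x ^ 2 - (2 * m) * h x + m ^ 2 := fun x => by ring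
    simp_rw [this]
    have hi3 : Integrable (fun x => 2 * m * h x) μ := hi.const_mul _
    have hi4 : Integrable (fun x => h x ^ 2 - 2 * m * h x) μ := hi2.sub hi3
    rw [integral_add hi4 (integrable_const _), integral_sub hi2 hi3, integral_const_mul, ← hmdef]
    simp
    ring
  linarith

/-- `E f(x) f(y)` when the pairs `(x e, y e)` are independent with law `π`. -/
noncomputable def correlation (π : Measure (ℝ × ℝ)) (f : (ι → ℝ) → ℝ) : ℝ :=
  ∫ z, f (fun e => (z e).1) * f (fun e => (z e).2) ∂Measure.pi (fun _ : ι => π)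

theorem correlation_map (μ : Measure X) [IsProbabilityMeasure μ] {h : X → ℝ × ℝ}
    (hh : Measurable h) {f : (ι → ℝ) → ℝ} (hf : Measurable f) :
    correlation (μ.map h) f
      = ∫ z, f (fun e => (h (z e)).1) * f (fun e => (h (z e)).2) ∂Measure.pi (fun _ : ι => μ) := by
  have : IsProbabilityMeasure (μ.map h) := Measure.isProbabilityMeasure_map hh.aemeasurable
  rw [correlation, ← Measure.pi_map_pi (μ := fun _ : ι => μ) (f := fun _ => h)
    (fun _ => hh.aemeasurable), integral_map]
  · exact (measurable_pi_lambda _ fun e => hh.comp (measurable_pi_apply e)).aemeasurable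
  · refine Measurable.aestronglyMeasurable ?_
    exact (hf.comp (by fun_prop)).mul (hf.comp (by fun_prop))

theorem abs_correlation_le_one (π : Measure (ℝ × ℝ)) [IsProbabilityMeasure π]
    {f : (ι → ℝ) → ℝ} (hb : ∀ x, |f x| ≤ 1) : |correlation π f| ≤ 1 := by
  have := norm_integral_le_of_norm_le_const (μ := Measure.pi (fun _ : ι => π)) (C := 1)
    (f := fun z => f (fun e => (z e).1) * f (fun e => (z e).2)) (ae_of_all _ fun z => by
      rw [norm_mul]; exact mul_le_one₀ (hb _) (norm_nonneg _) (hb _))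
  simpa [correlation] using this

/-- Let g(x) be the mean of f(q(x, ·)) over the noise. The left side is (E f g)² ≤ E f²g² ≤ E g²,
and E g² is the right side because two copies that share x and have independent noise are
conditionally independent given x. -/
theorem sq_correlation_le (α : Measure ℝ) (ν : Measure Y) [IsProbabilityMeasure α]
    [IsProbabilityMeasure ν] {q : ℝ × Y → ℝ} (hq : Measurable q) {f : (ι → ℝ) → ℝ}
    (hf : Measurable f) (hb : ∀ x, |f x| ≤ 1) :
    correlation ((α.prod ν).map fun w => (w.1, q w)) f ^ 2
      ≤ correlation ((α.prod (ν.prod ν)).map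
          fun w => (q (w.1, w.2.1), q (w.1, w.2.2))) f := by
  let Q : (ι → ℝ) → (ι → Y) → ι → ℝ := fun x u e => q (x e, u e)
  have hQ : Measurable fun p : (ι → ℝ) × (ι → Y) => Q p.1 p.2 :=
    measurable_pi_lambda _ fun e => hq.comp (by fun_prop)
  have hfQ : Measurable fun p : (ι → ℝ) × (ι → Y) => f (Q p.1 p.2) := hf.comp hQ
  let g : (ι → ℝ) → ℝ := fun x => ∫ u, f (Q x u) ∂Measure.pi (fun _ : ι => ν)
  have hg : Measurable g := hfQ.stronglyMeasurable.integral_prod_right'.measurable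
  have hgb : ∀ x, |g x| ≤ 1 := fun x => by
    have := norm_integral_le_of_norm_le_const (μ := Measure.pi (fun _ : ι => ν)) (C := 1)
      (f := fun u => f (Q x u)) (ae_of_all _ fun u => hb _)
    simpa using this
  have e1 : correlation ((α.prod ν).map fun w => (w.1, q w)) f
      = ∫ x, f x * g x ∂Measure.pi (fun _ : ι => α) := by
    rw [correlation_map _ (by fun_prop) hf]
    refine (integral_pi_prod α ν fun p => f p.1 * f (Q p.1 p.2)).trans ?_
    rw [integral_prod]
    · simp_rw [integral_const_mul]; rfl
    · refine .of_bound ((hf.comp measurable_fst).mul hfQ).aestronglyMeasurable 1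
        (ae_of_all _ fun p => ?_)
      rw [norm_mul]; exact mul_le_one₀ (hb _) (norm_nonneg _) (hb _)
  have e2 : correlation ((α.prod (ν.prod ν)).map
      fun w => (q (w.1, w.2.1), q (w.1, w.2.2))) f
      = ∫ x, g x ^ 2 ∂Measure.pi (fun _ : ι => α) := by
    rw [correlation_map _ (by fun_prop) hf]
    refine (integral_pi_prod α (ν.prod ν) fun p => f (Q p.1 fun e => (p.2 e).1)
      * f (Q p.1 fun e => (p.2 e).2)).trans ?_
    rw [integral_prod]
    · refine integral_congr_ae (ae_of_all _ fun x => ?_)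
      refine (integral_pi_prod ν ν fun p => f (Q x p.1) * f (Q x p.2)).trans ?_
      rw [integral_prod_mul (fun u => f (Q x u)) (fun u => f (Q x u))]
      exact (sq (g x)).symm
    · refine .of_bound (Measurable.aestronglyMeasurable ?_) 1
        (ae_of_all _ fun p => ?_)
      · refine Measurable.mul ?_ ?_
        · exact hfQ.comp (measurable_fst.prodMk (by fun_prop))
        · exact hfQ.comp (measurable_fst.prodMk (by fun_prop))
      rw [norm_mul]; exact mul_le_one₀ (hb _) (norm_nonneg _) (hb _)
  rw [e1, e2]
  have hfg : ∀ x, |f x * g x| ≤ 1 := fun x => by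
    rw [abs_mul]; exact mul_le_one₀ (hb _) (abs_nonneg _) (hgb _)
  refine (sq_integral_le_integral_sq _ (hf.mul hg) hfg).trans ?_
  refine integral_mono_of_nonneg (ae_of_all _ fun x => sq_nonneg _) ?_ (ae_of_all _ fun x => ?_)
  · refine .of_bound (hg.pow_const 2).aestronglyMeasurable 1 (ae_of_all _ fun x => ?_)
    rw [Real.norm_eq_abs, abs_of_nonneg (sq_nonneg _), sq_le_one_iff_abs_le_one]; exact hgb x
  · simp only [Pi.mul_apply, mul_pow]
    exact mul_le_of_le_one_left (sq_nonneg _) ((sq_le_one_iff_abs_le_one _).2 (hb x))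

/-- If fewer than `d` coordinates never determine `f` up to a sign flip, then the correlation of
`f` under a law that is `δ`-close to one that is odd in the first coordinate is `O(δ ^ d)`. -/
theorem abs_integral_le_of_flip [DecidableEq ι] (μ : Measure Z) [IsProbabilityMeasure μ]
    {x y a k : Z → ℝ} {flip : Z → Z} (hx : Measurable x) (hy : Measurable y)
    (hflip : MeasurePreserving flip μ μ) (hxf : ∀ z, x (flip z) = -x z)
    (haf : ∀ z, a (flip z) = a z) (hyf : ∀ z, a z ≠ 0 → y (flip z) = y z)
    (ha : Integrable a μ) (hk : Integrable k μ) {δ : ℝ} (ha1 : ∫ z, |a z| ∂μ ≤ 1)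
    (hkδ : ∫ z, |k z| ∂μ ≤ δ) (hδ1 : δ ≤ 1) {d : ℕ} {f : (ι → ℝ) → ℝ} (hf : Measurable f)
    (hb : ∀ v, |f v| ≤ 1)
    (hodd : ∀ S : Finset ι, S.card < d → ∃ T : Finset ι, Disjoint S T ∧
      ∀ v, f (fun e => if e ∈ T then -v e else v e) = -f v) :
    |∫ z, f (fun e => x (z e)) * f (fun e => y (z e)) * ∏ e, (k (z e) + a (z e))
      ∂Measure.pi (fun _ : ι => μ)| ≤ 2 ^ Fintype.card ι * δ ^ d := by
  have hδ0 : 0 ≤ δ := (integral_nonneg fun z => abs_nonneg _).trans hkδ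
  have hfx : Measurable fun z : ι → Z => f (fun e => x (z e)) := hf.comp (by fun_prop)
  have hfy : Measurable fun z : ι → Z => f (fun e => y (z e)) := hf.comp (by fun_prop)
  -- In the expansion of the product, S is the set of coordinates that contribute the small factor
  -- `k`. There are 2^|ι| such sets, which is the constant in the bound.
  let c : Finset ι → ι → Z → ℝ := fun S e => if e ∈ S then k else a
  have hc : ∀ S e, Integrable (c S e) μ := fun S e => by
    by_cases h : e ∈ S <;> simp [c, h, ha, hk]
  have hprod : ∀ S, Integrable (fun z : ι → Z => ∏ e, c S e (z e))
      (Measure.pi (fun _ : ι => μ)) := fun S => Integrable.fintype_prod (hc S)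
  have hterm : ∀ S, Integrable (fun z : ι → Z => f (fun e => x (z e)) * f (fun e => y (z e)) *
      ∏ e, c S e (z e)) (Measure.pi (fun _ : ι => μ)) := fun S => by
    refine (hprod S).bdd_mul (c := 1) (hfx.mul hfy).aestronglyMeasurable (ae_of_all _ fun z => ?_)
    rw [norm_mul]; exact mul_le_one₀ (hb _) (norm_nonneg _) (hb _)
  have hexp : ∀ z : ι → Z, ∏ e, (k (z e) + a (z e))
      = ∑ S : Finset ι, ∏ e, c S e (z e) := fun z => by
    rw [Finset.prod_add, Finset.powerset_univ]
    refine Finset.sum_congr rfl fun S _ => ?_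
    rw [← Finset.prod_mul_prod_compl S, Finset.compl_eq_univ_sdiff]
    congr 1
    · exact Finset.prod_congr rfl fun e he => by simp [c, he]
    · exact Finset.prod_congr rfl fun e he => by simp [c, (Finset.mem_sdiff.1 he).2]
  simp_rw [hexp, Finset.mul_sum]
  rw [integral_finsetSum _ fun S _ => hterm S]
  refine (Finset.abs_sum_le_sum_abs _ _).trans ?_
  refine (Finset.sum_le_card_nsmul _ _ (δ ^ d) fun S _ => ?_).trans (by simp)
  -- For small S the term vanishes by antisymmetry: flipping the coordinates in T preserves the
  -- measure and the weights and negates the first factor. For large S absolute values give δ^|S|.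
  by_cases hS : S.card < d
  · obtain ⟨T, hST, hT⟩ := hodd S hS
    set I := ∫ z, f (fun e => x (z e)) * f (fun e => y (z e)) * ∏ e, c S e (z e)
      ∂Measure.pi (fun _ : ι => μ) with hI
    have hmp : MeasurePreserving (fun (z : ι → Z) e => (if e ∈ T then flip else id) (z e))
        (Measure.pi fun _ => μ) (Measure.pi fun _ => μ) := by
      refine measurePreserving_pi (fun _ => μ) (fun _ => μ)
        (f := fun e => if e ∈ T then flip else id) fun e => ?_
      by_cases h : e ∈ T
      · simpa [h] using hflip
      · simpa [h] using MeasurePreserving.id μ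
    have hneg : I = -I := by
      conv_lhs => rw [hI, ← hmp.map_eq]
      rw [integral_map hmp.measurable.aemeasurable
        (by rw [hmp.map_eq]; exact (hterm S).aestronglyMeasurable), hI, ← integral_neg]
      refine integral_congr_ae (ae_of_all _ fun z => ?_)
      have hx' : f (fun e => x ((if e ∈ T then flip else id) (z e))) = -f (fun e => x (z e)) := by
        rw [← hT]
        congr 1
        ext e
        split_ifs <;> simp [hxf]
      have hc' : ∀ e, c S e ((if e ∈ T then flip else id) (z e)) = c S e (z e) := fun e => by
        by_cases h : e ∈ T
        · have : e ∉ S := fun h' => Finset.disjoint_left.1 hST h' h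
          simp [c, h, this, haf]
        · simp [h]
      simp only [hx', hc']
      -- Invariance of `y` under the flip is only known where `a` does not vanish; elsewhere the
      -- whole integrand is zero.
      by_cases h0 : ∏ e, c S e (z e) = 0
      · simp [h0]
      · have hy' : ∀ e, y ((if e ∈ T then flip else id) (z e)) = y (z e) := fun e => by
          by_cases h : e ∈ T
          · have hS' : e ∉ S := fun h' => Finset.disjoint_left.1 hST h' h
            have := (Finset.prod_ne_zero_iff.1 h0) e (Finset.mem_univ e)
            simp only [c, hS', if_false] at this
            simp [h, hyf _ this]
          · simp [h]
        simp only [hy']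
        ring
    have : I = 0 := by linarith
    rw [this, abs_zero]
    positivity
  · calc _ ≤ ∫ z, |∏ e, c S e (z e)| ∂Measure.pi (fun _ : ι => μ) := by
          refine (abs_integral_le_integral_abs).trans ?_
          refine integral_mono_of_nonneg (ae_of_all _ fun z => abs_nonneg _) (hprod S).abs
            (ae_of_all _ fun z => ?_)
          simp only [abs_mul]
          refine mul_le_of_le_one_left (abs_nonneg _) (mul_le_one₀ (hb _) (abs_nonneg _) (hb _))
      _ = ∏ e, ∫ z, |c S e z| ∂μ := by
          simp_rw [Finset.abs_prod]
          exact integral_fintype_prod_eq_prod fun e z => |c S e z|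
      _ ≤ ∏ e, (if e ∈ S then δ else 1) := by
          refine Finset.prod_le_prod (fun e _ => integral_nonneg fun z => abs_nonneg _) fun e _ => ?_
          by_cases h : e ∈ S <;> simp [c, h, ha1, hkδ]
      _ = δ ^ S.card := by simp [Finset.prod_ite_mem, Finset.prod_const]
      _ ≤ δ ^ d := pow_le_pow_of_le_one hδ0 hδ1 (not_lt.1 hS)

end Correlation

/-! ### Removing the constant by doubling the time -/

/-- A function that satisfies `φ(t)² ≤ φ(2t)` and decays at rate `d` at infinity is bounded by
`exp (-d t)`. -/
theorem le_exp_neg_of_sq_le_of_decay {φ : ℝ≥0 → ℝ} {d : ℕ} {C : ℝ} {t₀ : ℝ≥0}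
    (h1 : ∀ t, φ t ≤ 1) (hsq : ∀ t, φ t ^ 2 ≤ φ (2 * t))
    (hC : ∀ t, t₀ ≤ t → φ t ≤ C * Real.exp (-(t : ℝ)) ^ d) (t : ℝ≥0) :
    φ t ≤ Real.exp (-((t : ℝ) * d)) := by
  have hexp : ∀ s : ℝ≥0, Real.exp (-(s : ℝ)) ^ d = Real.exp (-((s : ℝ) * d)) := fun s => by
    rw [← Real.exp_nat_mul]; ring_nf
  rcases eq_or_lt_of_le (zero_le : 0 ≤ t) with rfl | ht
  · simpa using h1 0
  have h0 : ∀ s, 0 ≤ φ s := fun s => by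
    have := hsq (s / 2)
    rw [mul_div_cancel₀ s two_ne_zero] at this
    exact (sq_nonneg _).trans this
  have hpow : ∀ n : ℕ, φ t ^ 2 ^ n ≤ φ (2 ^ n * t) := fun n => by
    induction n with
    | zero => simp
    | succ n ih =>
      rw [pow_succ, pow_mul]
      refine (pow_le_pow_left₀ (pow_nonneg (h0 t) _) ih 2).trans ((hsq _).trans (le_of_eq ?_))
      congr 1
      ring
  -- If q = φ(t) e^{td} exceeded 1, doubling the time n times would give q^(2^n) ≤ C for all large
  -- n, although the left side is unbounded.
  by_contra! hlt
  set q := φ t * Real.exp ((t : ℝ) * d) with hq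
  have hq1 : 1 < q := by
    have := mul_lt_mul_of_pos_right hlt (Real.exp_pos ((t : ℝ) * d))
    rwa [← Real.exp_add, neg_add_cancel, Real.exp_zero] at this
  have hlim : Filter.Tendsto (fun n : ℕ => q ^ 2 ^ n) Filter.atTop Filter.atTop :=
    (tendsto_pow_atTop_atTop_of_one_lt hq1).comp (tendsto_pow_atTop_atTop_of_one_lt one_lt_two)
  have hlim2 : Filter.Tendsto (fun n : ℕ => (2 : ℝ≥0) ^ n * t) Filter.atTop Filter.atTop :=
    (tendsto_pow_atTop_atTop_of_one_lt one_lt_two).atTop_mul_const ht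
  obtain ⟨n, hn1, hn2⟩ := ((hlim.eventually_gt_atTop C).and
    (hlim2.eventually_ge_atTop t₀)).exists
  have h3 := (hpow n).trans (hC _ hn2)
  rw [hexp] at h3
  have h4 : q ^ 2 ^ n ≤ C := by
    rw [hq, mul_pow, ← Real.exp_nat_mul]
    calc _ ≤ C * Real.exp (-(((2 ^ n * t : ℝ≥0) : ℝ) * d)) *
          Real.exp (((2 ^ n : ℕ) : ℝ) * ((t : ℝ) * d)) := by gcongr
      _ = C := by
          rw [mul_assoc, ← Real.exp_add]
          have : -(((2 ^ n * t : ℝ≥0) : ℝ) * d) + ((2 ^ n : ℕ) : ℝ) * ((t : ℝ) * d) = 0 := by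
            push_cast; ring
          rw [this]; simp
  linarith

/-! ### Two perturbations of one coordinate: the time-doubling identities -/

theorem charFunDual_gaussianReal_zero_one (L : StrongDual ℝ ℝ) :
    charFunDual (gaussianReal 0 1) L = Complex.exp (-((L 1 : ℝ) : ℂ) ^ 2 / 2) := by
  have h := charFun_gaussianReal (μ := 0) (v := 1) (L 1)
  rw [charFun_apply_real] at h
  rw [charFunDual_apply]
  have hL : ∀ x, L x = L 1 * x := fun x => by
    have := L.map_smul x 1
    simpa [mul_comm] using this
  have : ∀ x : ℝ, Complex.exp ((L x : ℝ) * Complex.I) = Complex.exp ((L 1 : ℝ) * x * Complex.I) :=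
    fun x => by rw [hL x]; push_cast; rfl
  simp_rw [this]
  rw [h]
  congr 1
  simp [neg_div]

/-- Both laws are centred Gaussian with unit variances and covariance ρ², so their characteristic
functions agree. -/
theorem gaussian_map_pair_eq {ρ κ κ₂ : ℝ} (h : ρ ^ 2 + κ ^ 2 = 1) (h₂ : (ρ ^ 2) ^ 2 + κ₂ ^ 2 = 1) :
    ((gaussianReal 0 1).prod ((gaussianReal 0 1).prod (gaussianReal 0 1))).map
        (fun w : ℝ × ℝ × ℝ => (ρ * w.1 + κ * w.2.1, ρ * w.1 + κ * w.2.2))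
      = ((gaussianReal 0 1).prod (gaussianReal 0 1)).map
        (fun w : ℝ × ℝ => (w.1, ρ ^ 2 * w.1 + κ₂ * w.2)) := by
  let A : ℝ × ℝ × ℝ →L[ℝ] ℝ × ℝ :=
    (ρ • ContinuousLinearMap.fst ℝ ℝ (ℝ × ℝ) +
      κ • (ContinuousLinearMap.fst ℝ ℝ ℝ ∘L ContinuousLinearMap.snd ℝ ℝ (ℝ × ℝ))).prod
    (ρ • ContinuousLinearMap.fst ℝ ℝ (ℝ × ℝ) +
      κ • (ContinuousLinearMap.snd ℝ ℝ ℝ ∘L ContinuousLinearMap.snd ℝ ℝ (ℝ × ℝ)))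
  let B : ℝ × ℝ →L[ℝ] ℝ × ℝ :=
    (ContinuousLinearMap.fst ℝ ℝ ℝ).prod
    (ρ ^ 2 • ContinuousLinearMap.fst ℝ ℝ ℝ + κ₂ • ContinuousLinearMap.snd ℝ ℝ ℝ)
  have hA : (fun w : ℝ × ℝ × ℝ => (ρ * w.1 + κ * w.2.1, ρ * w.1 + κ * w.2.2)) = A := by
    ext w <;> simp [A]
  have hB : (fun w : ℝ × ℝ => (w.1, ρ ^ 2 * w.1 + κ₂ * w.2)) = B := by
    ext w <;> simp [B]
  rw [hA, hB]
  have : IsProbabilityMeasure (((gaussianReal 0 1).prod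
      ((gaussianReal 0 1).prod (gaussianReal 0 1))).map A) :=
    Measure.isProbabilityMeasure_map (by fun_prop)
  have : IsProbabilityMeasure (((gaussianReal 0 1).prod (gaussianReal 0 1)).map B) :=
    Measure.isProbabilityMeasure_map (by fun_prop)
  refine Measure.ext_of_charFunDual ?_
  ext L
  rw [charFunDual_map, charFunDual_map, charFunDual_prod, charFunDual_prod, charFunDual_prod]
  simp only [charFunDual_gaussianReal_zero_one, ← Complex.exp_add]
  have hL : ∀ x y : ℝ, L (x, y) = x * L (1, 0) + y * L (0, 1) := fun x y => by
    rw [← smul_eq_mul, ← smul_eq_mul, ← L.map_smul, ← L.map_smul, ← L.map_add]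
    simp
  congr 1
  simp [A, B]
  rw [hL ρ ρ, hL κ 0, hL 0 κ, hL 1 (ρ ^ 2), hL 0 κ₂]
  have hc : (ρ : ℂ) ^ 2 + κ ^ 2 = 1 := by exact_mod_cast h
  have hc₂ : ((ρ : ℂ) ^ 2) ^ 2 + κ₂ ^ 2 = 1 := by exact_mod_cast h₂
  push_cast
  linear_combination (-(L (1, 0) : ℂ) ^ 2 / 2 - (L (0, 1) : ℂ) ^ 2 / 2) * hc
    + (L (0, 1) : ℂ) ^ 2 / 2 * hc₂

theorem lintegral_bernoulliMeasure (p : unitInterval) {F : ℝ → ℝ≥0∞} :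
    ∫⁻ b, F b ∂bernoulliMeasure (1 : ℝ) 0 p
      = (unitInterval.toNNReal p : ℝ≥0∞) * F 1
        + (unitInterval.toNNReal (unitInterval.symm p) : ℝ≥0∞) * F 0 := by
  rw [bernoulliMeasure_def, lintegral_add_measure, lintegral_smul_measure, lintegral_smul_measure,
    lintegral_dirac, lintegral_dirac]
  rfl

theorem lintegral_refresh (γ : Measure ℝ) [IsProbabilityMeasure γ] (p : unitInterval) (z : ℝ)
    {F : ℝ → ℝ≥0∞} (hF : Measurable F) :
    ∫⁻ u, F (u.2 * z + (1 - u.2) * u.1) ∂γ.prod (bernoulliMeasure (1 : ℝ) 0 p)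
      = (unitInterval.toNNReal p : ℝ≥0∞) * F z
        + (unitInterval.toNNReal (unitInterval.symm p) : ℝ≥0∞) * ∫⁻ y, F y ∂γ := by
  rw [lintegral_prod _ (by fun_prop)]
  simp_rw [lintegral_bernoulliMeasure]
  rw [lintegral_add_left (by fun_prop), lintegral_const_mul _ (by fun_prop),
    lintegral_const_mul _ (by fun_prop)]
  simp

/-- On both sides the two coordinates coincide with probability p² and are otherwise independent
with law γ: two refreshed copies of the same value share it exactly when neither has been resampled.
-/
theorem refresh_map_pair_eq (γ : Measure ℝ) [IsProbabilityMeasure γ] {p p₂ : unitInterval}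
    (hp : (p₂ : ℝ) = p ^ 2) :
    (γ.prod ((γ.prod (bernoulliMeasure (1 : ℝ) 0 p)).prod
        (γ.prod (bernoulliMeasure (1 : ℝ) 0 p)))).map
      (fun w => (w.2.1.2 * w.1 + (1 - w.2.1.2) * w.2.1.1, w.2.2.2 * w.1 + (1 - w.2.2.2) * w.2.2.1))
    = (γ.prod (γ.prod (bernoulliMeasure (1 : ℝ) 0 p₂))).map
      (fun w => (w.1, w.2.2 * w.1 + (1 - w.2.2) * w.2.1)) := by
  refine Measure.ext_of_lintegral _ fun F hF => ?_
  have h2 : ∀ x, Measurable fun y => F (x, y) := fun x => hF.comp (by fun_prop)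
  have h1 : ∀ y, Measurable fun x => F (x, y) := fun y => hF.comp (by fun_prop)
  rw [lintegral_map hF (by fun_prop), lintegral_map hF (by fun_prop),
    lintegral_prod _ (by fun_prop), lintegral_prod _ (by fun_prop)]
  simp_rw [fun z => lintegral_refresh γ p₂ z (h2 z)]
  have hI : Measurable fun x => ∫⁻ y, F (x, y) ∂γ := hF.lintegral_prod_right'
  have hI' : Measurable fun y => ∫⁻ x, F (x, y) ∂γ := hF.lintegral_prod_left'
  have hd : Measurable fun z => F (z, z) := by fun_prop
  have hin : ∀ z, ∫⁻ u, F (u.1.2 * z + (1 - u.1.2) * u.1.1, u.2.2 * z + (1 - u.2.2) * u.2.1)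
      ∂(γ.prod (bernoulliMeasure (1 : ℝ) 0 p)).prod (γ.prod (bernoulliMeasure (1 : ℝ) 0 p))
      = (unitInterval.toNNReal p : ℝ≥0∞) * ((unitInterval.toNNReal p : ℝ≥0∞) * F (z, z)
        + (unitInterval.toNNReal (unitInterval.symm p) : ℝ≥0∞) * ∫⁻ y, F (z, y) ∂γ)
        + (unitInterval.toNNReal (unitInterval.symm p) : ℝ≥0∞) *
          ((unitInterval.toNNReal p : ℝ≥0∞) * ∫⁻ x, F (x, z) ∂γ
        + (unitInterval.toNNReal (unitInterval.symm p) : ℝ≥0∞) *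
          ∫⁻ x, ∫⁻ y, F (x, y) ∂γ ∂γ) := fun z => by
    rw [lintegral_prod _ (by fun_prop)]
    simp_rw [fun x => lintegral_refresh γ p z (h2 x)]
    rw [lintegral_refresh γ p z (F := fun x => (unitInterval.toNNReal p : ℝ≥0∞) * F (x, z)
        + (unitInterval.toNNReal (unitInterval.symm p) : ℝ≥0∞) * ∫⁻ y, F (x, y) ∂γ)
        (((h1 z).const_mul _).add (hI.const_mul _)),
      lintegral_add_left ((h1 z).const_mul _), lintegral_const_mul _ (h1 z),
      lintegral_const_mul _ hI]
  simp_rw [hin]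
  have hsw : ∫⁻ y, ∫⁻ x, F (x, y) ∂γ ∂γ = ∫⁻ x, ∫⁻ y, F (x, y) ∂γ ∂γ :=
    lintegral_lintegral_swap (f := fun y x => F (x, y)) (by fun_prop)
  rw [lintegral_add_left (by fun_prop), lintegral_const_mul _ (by fun_prop),
    lintegral_add_left (by fun_prop), lintegral_const_mul _ (by fun_prop),
    lintegral_const_mul _ (by fun_prop), lintegral_const_mul _ (by fun_prop),
    lintegral_add_left (by fun_prop), lintegral_const_mul _ (by fun_prop),
    lintegral_add_left (by fun_prop), lintegral_const_mul _ (by fun_prop),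
    lintegral_const_mul _ (by fun_prop), lintegral_const, hsw,
    lintegral_const_mul _ (by fun_prop)]
  simp only [measure_univ, mul_one]
  set I := ∫⁻ x, ∫⁻ y, F (x, y) ∂γ ∂γ
  set D := ∫⁻ z, F (z, z) ∂γ
  have e1 : unitInterval.toNNReal p₂ = unitInterval.toNNReal p * unitInterval.toNNReal p := by
    ext; simp [hp, sq]
  have e2 : unitInterval.toNNReal (unitInterval.symm p₂)
      = unitInterval.toNNReal p * unitInterval.toNNReal (unitInterval.symm p)
        + unitInterval.toNNReal (unitInterval.symm p) := by
    ext; simp [hp]; ring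
  have e3 : unitInterval.toNNReal p + unitInterval.toNNReal (unitInterval.symm p) = 1 := by
    ext; simp
  rw [e1, e2]
  -- The weight 1 - p² appears as p(1 - p) + (1 - p), without subtraction. Splitting the last term
  -- as (1 - p)(p + (1 - p)) matches the three cases in which some copy is resampled.
  have e4 : (unitInterval.toNNReal (unitInterval.symm p) : ℝ≥0∞)
      = (unitInterval.toNNReal (unitInterval.symm p) : ℝ≥0∞) * ((unitInterval.toNNReal p : ℝ≥0∞) +
        (unitInterval.toNNReal (unitInterval.symm p) : ℝ≥0∞)) := by
    rw [← ENNReal.coe_add, e3]; simp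
  push_cast
  conv_rhs => rw [add_mul]; enter [2, 2]; rw [e4]
  ring

/-! ### Product densities and the Mehler kernel -/

theorem pi_withDensity {ι X : Type*} [Fintype ι] [MeasurableSpace X] (μ : Measure X)
    [IsProbabilityMeasure μ] {k : X → ℝ≥0∞} (hk : Measurable k)
    [IsProbabilityMeasure (μ.withDensity k)] :
    Measure.pi (fun _ : ι => μ.withDensity k)
      = (Measure.pi fun _ : ι => μ).withDensity fun z => ∏ e, k (z e) := by
  refine Measure.pi_eq fun s hs => ?_
  rw [withDensity_apply _ (.univ_pi hs), ← lintegral_indicator (.univ_pi hs)]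
  have : ∀ z : ι → X, (Set.univ.pi s).indicator (fun z => ∏ e, k (z e)) z
      = ∏ e, (s e).indicator k (z e) := fun z => by
    by_cases h : z ∈ Set.univ.pi s
    · rw [Set.indicator_of_mem h]
      exact Finset.prod_congr rfl fun e _ => (Set.indicator_of_mem (h e trivial) _).symm
    · rw [Set.indicator_of_notMem h]
      obtain ⟨e, he⟩ : ∃ e, z e ∉ s e := by simpa [Set.mem_pi] using h
      exact (Finset.prod_eq_zero (Finset.mem_univ e) (Set.indicator_of_notMem he _)).symm
  simp_rw [this]
  have hind : iIndepFun (fun e (z : ι → X) => (s e).indicator k (z e))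
      (Measure.pi fun _ : ι => μ) :=
    iIndepFun_pi (X := fun e => (s e).indicator k) fun e => (hk.indicator (hs e)).aemeasurable
  rw [lintegral_prod_eq_prod_lintegral_of_indepFun _ _ hind
    fun e => (hk.indicator (hs e)).comp (measurable_pi_apply e)]
  refine Finset.prod_congr rfl fun e _ => ?_
  rw [withDensity_apply _ (hs e), ← lintegral_indicator (hs e),
    ← (measurePreserving_eval (fun _ : ι => μ) e).lintegral_comp (hk.indicator (hs e))]

/-- Density of the law of `(x, ρ x + κ y)` with respect to the law of `(x, y)`, two independent
standard Gaussian variables. -/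
noncomputable def mehlerDensity (ρ κ : ℝ) (z : ℝ × ℝ) : ℝ :=
  |κ|⁻¹ * Real.exp (z.2 ^ 2 / 2 - (z.2 - ρ * z.1) ^ 2 / (2 * κ ^ 2))

theorem measurable_mehlerDensity (ρ κ : ℝ) : Measurable (mehlerDensity ρ κ) := by
  unfold mehlerDensity; fun_prop

theorem mehlerDensity_nonneg (ρ κ : ℝ) (z : ℝ × ℝ) : 0 ≤ mehlerDensity ρ κ z := by
  unfold mehlerDensity; positivity

/-- Given x, the second coordinate is Gaussian with mean ρx and variance κ²; the kernel is the
quotient of its density by the standard one. -/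
theorem gaussian_map_eq_withDensity_mehler (ρ : ℝ) {κ : ℝ} (hκ : κ ≠ 0) :
    ((gaussianReal 0 1).prod (gaussianReal 0 1)).map (fun w : ℝ × ℝ => (w.1, ρ * w.1 + κ * w.2))
      = ((gaussianReal 0 1).prod (gaussianReal 0 1)).withDensity
          fun z => ENNReal.ofReal (mehlerDensity ρ κ z) := by
  have hK := (measurable_mehlerDensity ρ κ).ennreal_ofReal
  refine Measure.ext_of_lintegral _ fun F hF => ?_
  rw [lintegral_map hF (by fun_prop), lintegral_withDensity_eq_lintegral_mul _ hK hF,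
    lintegral_prod _ (by fun_prop), lintegral_prod _ (hK.mul hF).aemeasurable]
  refine lintegral_congr fun x => ?_
  set v : ℝ≥0 := NNReal.mk (κ ^ 2) (sq_nonneg κ) with hv
  have hv0 : v ≠ 0 := fun h => by
    have : κ ^ 2 = 0 := congrArg NNReal.toReal h
    exact hκ (pow_eq_zero_iff two_ne_zero |>.1 this)
  have hmap : (gaussianReal 0 1).map (fun y => ρ * x + κ * y) = gaussianReal (ρ * x) v := by
    have h1 := gaussianReal_map_const_mul (μ := 0) (v := 1) κ
    have h2 := gaussianReal_map_const_add (μ := κ * 0) (v := v * 1) (ρ * x)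
    rw [hv, ← h1, Measure.map_map (by fun_prop) (by fun_prop)] at h2
    simpa [Function.comp_def] using h2
  have hFx : Measurable fun y => F (x, y) := hF.comp (by fun_prop)
  have hKx : Measurable fun y => ENNReal.ofReal (mehlerDensity ρ κ (x, y)) :=
    hK.comp (by fun_prop)
  rw [← lintegral_map (f := fun y => F (x, y)) (g := fun y => ρ * x + κ * y) hFx (by fun_prop),
    hmap, gaussianReal_of_var_ne_zero _ hv0, gaussianReal_of_var_ne_zero _ one_ne_zero,
    lintegral_withDensity_eq_lintegral_mul _ (measurable_gaussianPDF _ _) hFx]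
  change _ = ∫⁻ y, ((fun y => ENNReal.ofReal (mehlerDensity ρ κ (x, y))) * fun y => F (x, y)) y ∂_
  rw [
    lintegral_withDensity_eq_lintegral_mul _ (measurable_gaussianPDF _ _) (hKx.mul hFx)]
  refine lintegral_congr fun y => ?_
  simp only [Pi.mul_apply]
  rw [← mul_assoc]
  congr 1
  rw [gaussianPDF, gaussianPDF, ← ENNReal.ofReal_mul (gaussianPDFReal_nonneg _ _ _)]
  congr 1
  rw [gaussianPDFReal, gaussianPDFReal, mehlerDensity]
  have hvc : (v : ℝ) = κ ^ 2 := rfl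
  rw [hvc, Real.sqrt_mul (by positivity), Real.sqrt_sq_eq_abs, mul_inv]
  simp only [NNReal.coe_one, mul_one, sub_zero]
  rw [mul_mul_mul_comm, ← Real.exp_add]
  congr 2
  ring

theorem integrable_exp_sq_div_four_gaussian :
    Integrable (fun x : ℝ => Real.exp (x ^ 2 / 4)) (gaussianReal 0 1) := by
  rw [gaussianReal_of_var_ne_zero _ one_ne_zero,
    integrable_withDensity_iff (measurable_gaussianPDF _ _)
      (ae_of_all _ fun x => gaussianPDF_lt_top)]
  have h := (integrable_exp_neg_mul_sq (b := 1 / 4) (by norm_num)).mul_const (√(2 * Real.pi))⁻¹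
  refine h.congr (ae_of_all _ fun x => ?_)
  simp only [toReal_gaussianPDF, gaussianPDFReal, NNReal.coe_one, mul_one, sub_zero]
  rw [mul_left_comm, ← Real.exp_add, mul_comm]
  congr 2
  ring

theorem abs_exp_sub_one_le_mul_exp_abs (u : ℝ) :
    |Real.exp u - 1| ≤ |u| * Real.exp |u| := by
  rcases le_total 0 u with h | h
  · rw [abs_of_nonneg h, abs_of_nonneg (by linarith [Real.one_le_exp h])]
    have := Real.add_one_le_exp (-u)
    have h2 := mul_le_mul_of_nonneg_left this (Real.exp_pos u).le
    rw [← Real.exp_add, add_neg_cancel, Real.exp_zero] at h2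
    linarith
  · rw [abs_of_nonpos h, abs_of_nonpos (by linarith [Real.exp_le_one_iff.2 h])]
    have := Real.add_one_le_exp u
    have h2 := Real.one_le_exp (neg_nonneg.2 h)
    nlinarith

/-- The exponent of the kernel is ρ(2xy - ρ(x² + y²)) / (2κ²), hence O(ρ). The envelope must be
linear in ρ and Gaussian-integrable; exp(x²/4) is, as 1/4 < 1/2. -/
theorem abs_mehlerDensity_sub_one_le {ρ κ : ℝ} (h0 : 0 ≤ ρ) (h1 : ρ ≤ 1 / 8)
    (h : ρ ^ 2 + κ ^ 2 = 1) (z : ℝ × ℝ) :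
    |mehlerDensity ρ κ z - 1|
      ≤ ρ * (17 * (Real.exp (z.1 ^ 2 / 4) * Real.exp (z.2 ^ 2 / 4))) := by
  obtain ⟨x, y⟩ := z
  simp only [mehlerDensity]
  have hκ2 : 63 / 64 ≤ κ ^ 2 := by nlinarith
  have hκ0 : 0 < κ ^ 2 := by linarith
  have hκa : 0 < |κ| := abs_pos.2 fun h => by simp [h] at hκ0
  have hκs : |κ| ^ 2 = κ ^ 2 := sq_abs κ
  have hκ1 : |κ| ≤ 1 := by nlinarith
  have hc1 : 1 ≤ |κ|⁻¹ := (one_le_inv₀ hκa).2 hκ1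
  have hc2 : |κ|⁻¹ ≤ 1 + ρ := by
    rw [inv_le_iff_one_le_mul₀ hκa]
    have : 1 - ρ ^ 2 ≤ |κ| := by nlinarith
    nlinarith
  set w := x ^ 2 + y ^ 2 with hw
  have hw0 : 0 ≤ w := by positivity
  set u := y ^ 2 / 2 - (y - ρ * x) ^ 2 / (2 * κ ^ 2) with hu
  have hu1 : |u| ≤ ρ * w := by
    have : u = (κ ^ 2 * y ^ 2 - (y - ρ * x) ^ 2) / (2 * κ ^ 2) := by
      have : κ ≠ 0 := abs_pos.1 hκa
      rw [hu]; field_simp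
    rw [this, abs_div, abs_of_pos (by positivity : 0 < 2 * κ ^ 2), div_le_iff₀ (by positivity)]
    have e : κ ^ 2 * y ^ 2 - (y - ρ * x) ^ 2 = ρ * (2 * x * y - ρ * w) := by
      rw [hw]; linear_combination y ^ 2 * h
    rw [e, abs_mul, abs_of_nonneg h0, mul_assoc ρ w]
    refine mul_le_mul_of_nonneg_left ?_ h0
    rw [abs_le]
    constructor <;> nlinarith [sq_nonneg (x + y), sq_nonneg (x - y)]
  have hu2 : |u| ≤ w / 8 := hu1.trans (by nlinarith)
  -- The assumption ρ ≤ 1/8 leaves e^{w/8} from the exponential; another e^{w/8} absorbs the factor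
  -- w, which gives e^{w/4}.
  have he : |Real.exp u - 1| ≤ ρ * (8 * Real.exp (w / 4)) := by
    refine (abs_exp_sub_one_le_mul_exp_abs u).trans ?_
    calc |u| * Real.exp |u| ≤ ρ * w * Real.exp (w / 8) := by gcongr
      _ ≤ ρ * (8 * Real.exp (w / 8)) * Real.exp (w / 8) := by
          gcongr
          linarith [Real.add_one_le_exp (w / 8)]
      _ = ρ * (8 * Real.exp (w / 4)) := by
          have : Real.exp (w / 4) = Real.exp (w / 8) * Real.exp (w / 8) := by
            rw [← Real.exp_add]; ring_nf
          rw [this]; ring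
  have hE : 1 ≤ Real.exp (w / 4) := Real.one_le_exp (by positivity)
  have hsplit : Real.exp (x ^ 2 / 4) * Real.exp (y ^ 2 / 4) = Real.exp (w / 4) := by
    rw [← Real.exp_add, hw]; ring_nf
  rw [hsplit]
  have : |κ|⁻¹ * Real.exp u - 1 = |κ|⁻¹ * (Real.exp u - 1) + (|κ|⁻¹ - 1) := by ring
  rw [this]
  refine (abs_add_le _ _).trans ?_
  rw [abs_mul, abs_of_pos (inv_pos.2 hκa), abs_of_nonneg (by linarith : 0 ≤ |κ|⁻¹ - 1)]
  have h3 : |κ|⁻¹ * |Real.exp u - 1| ≤ (9 / 8) * (ρ * (8 * Real.exp (w / 4))) := by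
    gcongr; linarith
  nlinarith

theorem exists_integral_abs_mehlerDensity_sub_one_le :
    ∃ D : ℝ, 0 < D ∧ ∀ ρ κ : ℝ, 0 ≤ ρ → ρ ≤ 1 / 8 → ρ ^ 2 + κ ^ 2 = 1 →
      Integrable (fun z => mehlerDensity ρ κ z - 1) ((gaussianReal 0 1).prod (gaussianReal 0 1)) ∧
      ∫ z, |mehlerDensity ρ κ z - 1| ∂(gaussianReal 0 1).prod (gaussianReal 0 1) ≤ D * ρ := by
  have hi : Integrable (fun z : ℝ × ℝ => 17 * (Real.exp (z.1 ^ 2 / 4) * Real.exp (z.2 ^ 2 / 4)))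
      ((gaussianReal 0 1).prod (gaussianReal 0 1)) :=
    (integrable_exp_sq_div_four_gaussian.mul_prod integrable_exp_sq_div_four_gaussian).const_mul _
  refine ⟨1 + ∫ z : ℝ × ℝ, 17 * (Real.exp (z.1 ^ 2 / 4) * Real.exp (z.2 ^ 2 / 4))
    ∂(gaussianReal 0 1).prod (gaussianReal 0 1), ?_, fun ρ κ h0 h1 h => ?_⟩
  · have := integral_nonneg (μ := (gaussianReal 0 1).prod (gaussianReal 0 1))
      (f := fun z : ℝ × ℝ => 17 * (Real.exp (z.1 ^ 2 / 4) * Real.exp (z.2 ^ 2 / 4)))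
      fun z => by positivity
    linarith
  · have hI : Integrable (fun z => mehlerDensity ρ κ z - 1)
        ((gaussianReal 0 1).prod (gaussianReal 0 1)) :=
      (hi.const_mul ρ).mono'
        ((measurable_mehlerDensity ρ κ).sub_const 1).aestronglyMeasurable
        (ae_of_all _ fun z => abs_mehlerDensity_sub_one_le h0 h1 h z)
    refine ⟨hI, ?_⟩
    refine (integral_mono hI.abs (hi.const_mul ρ)
      fun z => abs_mehlerDensity_sub_one_le h0 h1 h z).trans ?_
    rw [integral_const_mul]
    nlinarith

/-! ### The law of one coordinate and its perturbation -/

/-- The perturbation of one coordinate `J_e`, as a function of `(J_e, J'_e, B_e)`. -/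
noncomputable def perturbCoord (P : Perturbation) (t : ℝ≥0) (w : ℝ × ℝ × ℝ) : ℝ :=
  match P with
  | .continuous => Real.exp (-(t : ℝ)) * w.1 + Real.sqrt (1 - Real.exp (-2 * (t : ℝ))) * w.2.1
  | .discrete => w.2.2 * w.1 + (1 - w.2.2) * w.2.1

/-- The law of `(J'_e, B_e)`. -/
noncomputable def coordNoise (t : ℝ≥0) : Measure (ℝ × ℝ) :=
  (gaussianReal 0 1).prod (bernoulliMeasure (1 : ℝ) 0 (keepProb t))

/-- The law of `(J_e, J_e(t))`. -/
noncomputable def pairLaw (P : Perturbation) (t : ℝ≥0) : Measure (ℝ × ℝ) :=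
  ((gaussianReal 0 1).prod (coordNoise t)).map fun w => (w.1, perturbCoord P t w)

instance (t : ℝ≥0) : IsProbabilityMeasure (coordNoise t) := by unfold coordNoise; infer_instance

theorem measurable_perturbCoord (P : Perturbation) (t : ℝ≥0) : Measurable (perturbCoord P t) := by
  cases P <;> unfold perturbCoord <;> fun_prop

instance (P : Perturbation) (t : ℝ≥0) : IsProbabilityMeasure (pairLaw P t) :=
  Measure.isProbabilityMeasure_map
    (measurable_fst.prodMk (measurable_perturbCoord P t)).aemeasurable

theorem exp_neg_sq_add_sqrt_sq (t : ℝ≥0) :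
    Real.exp (-(t : ℝ)) ^ 2 + Real.sqrt (1 - Real.exp (-2 * (t : ℝ))) ^ 2 = 1 := by
  have h : Real.exp (-2 * (t : ℝ)) ≤ 1 := Real.exp_le_one_iff.2 (by simp)
  rw [Real.sq_sqrt (by linarith), ← Real.exp_nat_mul]
  have : ((2 : ℕ) : ℝ) * -(t : ℝ) = -2 * t := by push_cast; ring
  rw [this]; ring

theorem pairLaw_continuous (t : ℝ≥0) :
    pairLaw .continuous t = ((gaussianReal 0 1).prod (gaussianReal 0 1)).map fun w : ℝ × ℝ =>
      (w.1, Real.exp (-(t : ℝ)) * w.1 + Real.sqrt (1 - Real.exp (-2 * (t : ℝ))) * w.2) := by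
  have h : ((gaussianReal 0 1).prod (coordNoise t)).map (Prod.map id Prod.fst)
      = (gaussianReal 0 1).prod (gaussianReal 0 1) := by
    rw [← Measure.map_prod_map _ _ measurable_id measurable_fst, Measure.map_id]
    congr 1
    simp [coordNoise]
  rw [← h, Measure.map_map (by fun_prop) (by fun_prop)]
  rfl

/-- Reversibility and the semigroup property together: going back in time t from one perturbation to
J and forward to the other amounts to a perturbation of time 2t. With `sq_correlation_le` this gives
φ(t)² ≤ φ(2t). -/
theorem pairLaw_two_mul (P : Perturbation) (t : ℝ≥0) :
    pairLaw P (2 * t) = ((gaussianReal 0 1).prod ((coordNoise t).prod (coordNoise t))).map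
      fun w => (perturbCoord P t (w.1, w.2.1), perturbCoord P t (w.1, w.2.2)) := by
  have hexp : Real.exp (-((2 * t : ℝ≥0) : ℝ)) = Real.exp (-(t : ℝ)) ^ 2 := by
    rw [← Real.exp_nat_mul]; push_cast; ring_nf
  cases P with
  | continuous =>
    rw [pairLaw_continuous]
    have h : ((gaussianReal 0 1).prod ((coordNoise t).prod (coordNoise t))).map
        (Prod.map id (Prod.map Prod.fst Prod.fst))
        = (gaussianReal 0 1).prod ((gaussianReal 0 1).prod (gaussianReal 0 1)) := by
      rw [← Measure.map_prod_map _ _ measurable_id (by fun_prop), Measure.map_id,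
        ← Measure.map_prod_map _ _ measurable_fst measurable_fst]
      simp [coordNoise]
    have h2 := exp_neg_sq_add_sqrt_sq (2 * t)
    rw [hexp] at h2 ⊢
    rw [← gaussian_map_pair_eq (exp_neg_sq_add_sqrt_sq t) h2, ← h,
      Measure.map_map (by fun_prop) (by fun_prop)]
    rfl
  | discrete => exact (refresh_map_pair_eq (gaussianReal 0 1) (p := keepProb t) hexp).symm

/-! ### Decay of correlations at large times, then at all times -/

section Decay

variable {ι : Type*} [Fintype ι]

/-- Here `a` is the indicator of B = 0 and `k` that of B ≠ 0, of mass δ = e^{-t}. Where B = 0 the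
perturbed coordinate is J', which does not see a flip of J. -/
theorem correlation_pairLaw_discrete_le [DecidableEq ι] {d : ℕ} {f : (ι → ℝ) → ℝ} (hf : Measurable f)
    (hb : ∀ v, |f v| ≤ 1)
    (hodd : ∀ S : Finset ι, S.card < d → ∃ T : Finset ι, Disjoint S T ∧
      ∀ v, f (fun e => if e ∈ T then -v e else v e) = -f v) (t : ℝ≥0) :
    correlation (pairLaw .discrete t) f ≤ 2 ^ Fintype.card ι * Real.exp (-(t : ℝ)) ^ d := by
  rw [pairLaw, correlation_map _ (measurable_fst.prodMk (measurable_perturbCoord _ t)) hf]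
  have hs : MeasurableSet {z : ℝ × ℝ × ℝ | z.2.2 = 0} :=
    measurableSet_eq_fun (by fun_prop) measurable_const
  let a : ℝ × ℝ × ℝ → ℝ := {z : ℝ × ℝ × ℝ | z.2.2 = 0}.indicator fun _ => 1
  let k : ℝ × ℝ × ℝ → ℝ := {z : ℝ × ℝ × ℝ | z.2.2 = 0}ᶜ.indicator fun _ => 1
  have hak : ∀ z, k z + a z = 1 := fun z => by
    by_cases h : z.2.2 = 0 <;> simp [a, k, h]
  have ha0 : ∀ z, |a z| = a z := fun z => abs_of_nonneg (Set.indicator_nonneg (by simp) z)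
  have hk0 : ∀ z, |k z| = k z := fun z => abs_of_nonneg (Set.indicator_nonneg (by simp) z)
  have key := abs_integral_le_of_flip (ι := ι) ((gaussianReal 0 1).prod (coordNoise t))
    (x := Prod.fst) (y := perturbCoord .discrete t) (a := a) (k := k)
    (flip := Prod.map (fun x => -x) id) measurable_fst (measurable_perturbCoord _ t)
    (MeasurePreserving.prod ⟨measurable_neg, by simpa using gaussianReal_map_neg (μ := 0) (v := 1)⟩
      (MeasurePreserving.id _))
    (fun z => rfl) (fun z => by simp [a, Set.indicator]) (fun z hz => ?_)
    ((integrable_const 1).indicator hs) ((integrable_const 1).indicator hs.compl)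
    (δ := Real.exp (-(t : ℝ))) ?_ ?_ (Real.exp_le_one_iff.2 (by simp)) hf hb hodd
  · simp only [hak, Finset.prod_const_one, mul_one] at key
    exact (le_abs_self _).trans key
  · have : z.2.2 = 0 := by
      by_contra h
      exact hz (by simp [a, h])
    simp [perturbCoord, this]
  · simp_rw [ha0, a]
    rw [integral_indicator_const _ hs, smul_eq_mul, mul_one]
    exact measureReal_le_one
  · simp_rw [hk0, k]
    rw [integral_indicator_const _ hs.compl, smul_eq_mul, mul_one]
    have : {z : ℝ × ℝ × ℝ | z.2.2 = 0}ᶜ = Set.univ ×ˢ (Set.univ ×ˢ {0}ᶜ) := by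
      ext z; simp
    rw [this, measureReal_prod_prod, coordNoise, measureReal_prod_prod,
      bernoulliMeasure_real_apply_of_mem_of_notMem _ (by measurability) (by simp) (by simp)]
    simp [keepProb]

theorem correlation_withDensity (μ : Measure (ℝ × ℝ)) [IsProbabilityMeasure μ] {k : ℝ × ℝ → ℝ}
    (hk : Measurable k) (hk0 : ∀ z, 0 ≤ k z)
    [IsProbabilityMeasure (μ.withDensity fun z => ENNReal.ofReal (k z))] (f : (ι → ℝ) → ℝ) :
    correlation (μ.withDensity fun z => ENNReal.ofReal (k z)) f
      = ∫ z, f (fun e => (z e).1) * f (fun e => (z e).2) * ∏ e, k (z e)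
        ∂Measure.pi (fun _ : ι => μ) := by
  have hm : Measurable fun z : ι → ℝ × ℝ => ∏ e, ENNReal.ofReal (k (z e)) :=
    Finset.univ.measurable_prod fun e _ => hk.ennreal_ofReal.comp (measurable_pi_apply e)
  rw [correlation, pi_withDensity μ hk.ennreal_ofReal,
    integral_withDensity_eq_integral_toReal_smul hm
      (ae_of_all _ fun z => ENNReal.prod_lt_top fun e _ => ENNReal.ofReal_lt_top)]
  refine integral_congr_ae (ae_of_all _ fun z => ?_)
  simp only [ENNReal.toReal_prod, ENNReal.toReal_ofReal (hk0 _), smul_eq_mul]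
  ring

/-- Here `a` = 1 and `k` is the Mehler density minus 1, whose L¹ norm is at most D e^{-t} for large
t. Neither the constant nor t₀ matters after the doubling argument. -/
theorem exists_correlation_pairLaw_continuous_le [DecidableEq ι] {d : ℕ} {f : (ι → ℝ) → ℝ} (hf : Measurable f)
    (hb : ∀ v, |f v| ≤ 1)
    (hodd : ∀ S : Finset ι, S.card < d → ∃ T : Finset ι, Disjoint S T ∧
      ∀ v, f (fun e => if e ∈ T then -v e else v e) = -f v) :
    ∃ (C : ℝ) (t₀ : ℝ≥0), ∀ t, t₀ ≤ t →
      correlation (pairLaw .continuous t) f ≤ C * Real.exp (-(t : ℝ)) ^ d := by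
  obtain ⟨D, hD, hmeh⟩ := exists_integral_abs_mehlerDensity_sub_one_le
  have hlim : Filter.Tendsto (fun t : ℝ≥0 => Real.exp (-(t : ℝ))) Filter.atTop (nhds 0) :=
    Real.tendsto_exp_neg_atTop_nhds_zero.comp (NNReal.tendsto_coe_atTop.2 Filter.tendsto_id)
  -- The threshold 1/8 is needed for the kernel estimate, and D⁻¹ for δ = D e^{-t} ≤ 1.
  have hev := (hlim.eventually_le_const (show (0 : ℝ) < 1 / 8 by norm_num)).and
    (hlim.eventually_le_const (show (0 : ℝ) < D⁻¹ by positivity))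
  obtain ⟨t₀, ht₀⟩ := Filter.eventually_atTop.1 hev
  refine ⟨2 ^ Fintype.card ι * D ^ d, t₀, fun t ht => ?_⟩
  obtain ⟨h8, hDi⟩ := ht₀ t ht
  set ρ := Real.exp (-(t : ℝ)) with hρ
  set κ := Real.sqrt (1 - Real.exp (-2 * (t : ℝ))) with hκ
  have hρκ : ρ ^ 2 + κ ^ 2 = 1 := exp_neg_sq_add_sqrt_sq t
  have hρ0 : 0 < ρ := Real.exp_pos _
  have hκ0 : κ ≠ 0 := fun h => by
    rw [h] at hρκ
    nlinarith
  obtain ⟨hI, hle⟩ := hmeh ρ κ hρ0.le h8 hρκ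
  have hlaw : pairLaw .continuous t = ((gaussianReal 0 1).prod (gaussianReal 0 1)).withDensity
      fun z => ENNReal.ofReal (mehlerDensity ρ κ z) := by
    rw [pairLaw_continuous, gaussian_map_eq_withDensity_mehler ρ hκ0]
  have hprob := (inferInstance : IsProbabilityMeasure (pairLaw .continuous t))
  rw [hlaw] at hprob ⊢
  rw [correlation_withDensity _ (measurable_mehlerDensity ρ κ) (mehlerDensity_nonneg ρ κ)]
  have key := abs_integral_le_of_flip (ι := ι) ((gaussianReal 0 1).prod (gaussianReal 0 1))
    (x := Prod.fst) (y := Prod.snd) (a := fun _ => 1) (k := fun z => mehlerDensity ρ κ z - 1)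
    (flip := Prod.map (fun x => -x) id) measurable_fst measurable_snd
    (MeasurePreserving.prod ⟨measurable_neg, by simpa using gaussianReal_map_neg (μ := 0) (v := 1)⟩
      (MeasurePreserving.id _))
    (fun z => rfl) (fun z => rfl) (fun z _ => rfl)
    (integrable_const 1) hI (δ := D * ρ) (by simp) hle
    (by rwa [← le_div_iff₀' hD, one_div]) hf hb hodd
  simp only [sub_add_cancel] at key
  rw [mul_assoc, ← mul_pow]
  exact (le_abs_self _).trans key

/-- If no set of fewer than `d` coordinates determines the bounded function `f` up to a sign flip,
then `E f(J) f(J(t)) ≤ exp (-d t)`. -/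
theorem correlation_pairLaw_le [DecidableEq ι] (P : Perturbation) {d : ℕ} {f : (ι → ℝ) → ℝ} (hf : Measurable f)
    (hb : ∀ v, |f v| ≤ 1)
    (hodd : ∀ S : Finset ι, S.card < d → ∃ T : Finset ι, Disjoint S T ∧
      ∀ v, f (fun e => if e ∈ T then -v e else v e) = -f v) (t : ℝ≥0) :
    correlation (pairLaw P t) f ≤ Real.exp (-((t : ℝ) * d)) := by
  have hdecay : ∃ (C : ℝ) (t₀ : ℝ≥0), ∀ t, t₀ ≤ t →
      correlation (pairLaw P t) f ≤ C * Real.exp (-(t : ℝ)) ^ d := by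
    cases P with
    | continuous => exact exists_correlation_pairLaw_continuous_le hf hb hodd
    | discrete => exact ⟨_, 0, fun t _ => correlation_pairLaw_discrete_le hf hb hodd t⟩
  obtain ⟨C, t₀, hC⟩ := hdecay
  refine le_exp_neg_of_sq_le_of_decay (φ := fun t => correlation (pairLaw P t) f)
    (fun t => (le_abs_self _).trans (abs_correlation_le_one _ hb)) (fun t => ?_) hC t
  rw [pairLaw_two_mul]
  exact sq_correlation_le _ _ (measurable_perturbCoord P t) hf hb

end Decay

/-! ### Berge paths and separation -/

section Graph

variable {N : ℕ}

/-- A Berge path of length `ℓ` from `i` to `u` with hyperedges in `S`, indexed by `ℕ`. -/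
def BergeReach (S : Finset (Finset (Fin N))) (i u : Fin N) (ℓ : ℕ) : Prop :=
  ∃ (v : ℕ → Fin N) (e : ℕ → Finset (Fin N)), v 0 = i ∧ v ℓ = u ∧ Set.InjOn v (Set.Iic ℓ) ∧
    Set.InjOn e (Set.Iio ℓ) ∧ ∀ k < ℓ, e k ∈ S ∧ v k ∈ e k ∧ v (k + 1) ∈ e k

theorem BergeReach.refl (S : Finset (Finset (Fin N))) (i : Fin N) : BergeReach S i i 0 :=
  ⟨fun _ => i, fun _ => ∅, rfl, rfl, by simp [Set.InjOn], by simp [Set.InjOn], by simp⟩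

theorem BergeReach.le_card {S : Finset (Finset (Fin N))} {i u : Fin N} {ℓ : ℕ}
    (h : BergeReach S i u ℓ) : ℓ ≤ S.card := by
  obtain ⟨v, e, -, -, -, he, hk⟩ := h
  have := Finset.card_le_card_of_injOn (s := Finset.range ℓ) (t := S) e
    (fun k hk' => (hk k (by simpa using hk')).1) (by simpa using he)
  simpa using this

theorem BergeReach.dist_le {S E : Finset (Finset (Fin N))} (hS : S ⊆ E) {i u : Fin N} {ℓ : ℕ}
    (h : BergeReach S i u ℓ) : hypergraphDist E i u ≤ ℓ := by
  unfold hypergraphDist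
  split_ifs
  · exact zero_le
  · obtain ⟨v, e, h0, hℓ, hv, he, hk⟩ := h
    refine iInf₂_le ℓ ⟨fun k => v k, fun k => e k, h0, hℓ, fun a b hab => ?_, fun a b hab => ?_,
      fun k => hS (hk k k.2).1, fun k => (hk k k.2).2⟩
    · exact Fin.ext (hv (Nat.le_of_lt_succ a.2) (Nat.le_of_lt_succ b.2) hab)
    · exact Fin.ext (he a.2 b.2 hab)

/-- Cut the path at its first vertex in a. If w already occurs up to there, stop at w; otherwise
append a and w. -/
theorem BergeReach.step {S : Finset (Finset (Fin N))} {i u w : Fin N} {ℓ : ℕ}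
    (h : BergeReach S i u ℓ) {a : Finset (Fin N)} (ha : a ∈ S) (hu : u ∈ a) (hw : w ∈ a) :
    ∃ m, BergeReach S i w m := by
  classical
  obtain ⟨v, e, h0, hℓ, hv, he, hk⟩ := h
  have hex : ∃ k, v k ∈ a := ⟨ℓ, hℓ ▸ hu⟩
  set m := Nat.find hex with hm
  have hma : v m ∈ a := Nat.find_spec hex
  have hmin : ∀ k < m, v k ∉ a := fun k hk' => Nat.find_min hex hk'
  have hmℓ : m ≤ ℓ := Nat.find_min' hex (hℓ ▸ hu)
  by_cases hwv : ∃ k ≤ m, v k = w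
  · obtain ⟨k, hkm, hkw⟩ := hwv
    refine ⟨k, v, e, h0, hkw, hv.mono ?_, he.mono ?_, fun j hj => hk j (by omega)⟩
    · exact Set.Iic_subset_Iic.2 (hkm.trans hmℓ)
    · exact Set.Iio_subset_Iio (hkm.trans hmℓ)
  · push Not at hwv
    -- The k-th hyperedge contains the k-th vertex, which is outside a by minimality, so the
    -- appended hyperedge is new.
    have hea : ∀ k < m, e k ≠ a := fun k hkm h => hmin k hkm (h ▸ (hk k (by omega)).2.1)
    refine ⟨m + 1, Function.update v (m + 1) w, Function.update e m a, by simpa using h0, by simp,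
      ?_, ?_, fun k hkm => ?_⟩
    · intro x hx y hy hxy
      simp only [Set.mem_Iic] at hx hy
      rcases eq_or_lt_of_le hx with rfl | hx' <;> rcases eq_or_lt_of_le hy with rfl | hy'
      · rfl
      · rw [Function.update_self, Function.update_of_ne (by omega)] at hxy
        exact absurd hxy.symm (hwv y (by omega))
      · rw [Function.update_self, Function.update_of_ne (by omega)] at hxy
        exact absurd hxy (hwv x (by omega))
      · rw [Function.update_of_ne (by omega), Function.update_of_ne (by omega)] at hxy
        exact hv (Set.mem_Iic.2 (by omega)) (Set.mem_Iic.2 (by omega)) hxy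
    · intro x hx y hy hxy
      simp only [Set.mem_Iio] at hx hy
      rcases eq_or_lt_of_le (Nat.le_of_lt_succ hx) with rfl | hx' <;>
        rcases eq_or_lt_of_le (Nat.le_of_lt_succ hy) with hy' | hy'
      · exact hy'.symm
      · rw [Function.update_self, Function.update_of_ne (by omega)] at hxy
        exact absurd hxy.symm (hea y (by omega))
      · rw [hy', Function.update_self, Function.update_of_ne (by omega)] at hxy
        exact absurd hxy (hea x (by omega))
      · rw [Function.update_of_ne (by omega), Function.update_of_ne (by omega)] at hxy
        exact he (Set.mem_Iio.2 (by omega)) (Set.mem_Iio.2 (by omega)) hxy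
    · rcases eq_or_lt_of_le (Nat.le_of_lt_succ hkm) with h | h
      · subst h
        rw [Function.update_self, Function.update_of_ne (by omega), Function.update_self]
        exact ⟨ha, hma, hw⟩
      · rw [Function.update_of_ne (by omega), Function.update_of_ne (by omega),
          Function.update_of_ne (by omega)]
        exact hk k (by omega)

/-- Sites at distance more than `r` are separated by any set of at most `r` hyperedges. -/
theorem exists_separating {E S : Finset (Finset (Fin N))} {i j : Fin N} {r : ℕ}
    (hd : ¬ hypergraphDist E i j ≤ r) (hS : S ⊆ E) (hr : S.card ≤ r) :
    ∃ V : Finset (Fin N), i ∈ V ∧ j ∉ V ∧ ∀ a ∈ S, Disjoint a V ∨ a ⊆ V := by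
  classical
  -- V is the set of vertices reachable from i inside S. It omits j because a Berge path has
  -- distinct hyperedges, so its length is at most |S| ≤ r.
  refine ⟨Finset.univ.filter fun u => ∃ ℓ, BergeReach S i u ℓ, ?_, ?_, fun a ha => ?_⟩
  · simpa using ⟨0, BergeReach.refl S i⟩
  · simp only [Finset.mem_filter, Finset.mem_univ, true_and]
    rintro ⟨ℓ, h⟩
    exact hd ((h.dist_le hS).trans (by exact_mod_cast h.le_card.trans hr))
  · rw [or_iff_not_imp_left, Finset.not_disjoint_iff]
    rintro ⟨u, hu, hu'⟩ w hw
    obtain ⟨ℓ, h⟩ := (Finset.mem_filter.1 hu').2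
    exact Finset.mem_filter.2 ⟨Finset.mem_univ _, h.step ha hu hw⟩

theorem eq_of_hypergraphDist_le_zero {E : Finset (Finset (Fin N))} {x y : Fin N}
    (h : hypergraphDist E x y ≤ (0 : ℕ)) : x = y := by
  by_contra hne
  have h1 : (1 : ℕ∞) ≤ hypergraphDist E x y := by
    rw [hypergraphDist, if_neg hne]
    refine le_iInf₂ fun ℓ hℓ => ?_
    obtain ⟨v, e, hp⟩ := hℓ
    rcases Nat.eq_zero_or_pos ℓ with rfl | hpos
    · exact absurd (hp.start.symm.trans hp.finish) hne
    · exact_mod_cast hpos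
  exact absurd (h1.trans h) (by simp)

theorem card_hypergraphBall_le_maxBallCard (E : Finset (Finset (Fin N))) (r : ℕ) (i : Fin N) :
    (hypergraphBall E r i).card ≤ maxBallCard E r :=
  Finset.le_sup (f := fun i => (hypergraphBall E r i).card) (Finset.mem_univ i)

theorem maxBallCard_zero_le (E : Finset (Finset (Fin N))) : maxBallCard E 0 ≤ 1 := by
  classical
  refine Finset.sup_le fun i _ => Finset.card_le_one.2 fun a ha b hb => ?_
  simp only [hypergraphBall, Finset.mem_filter, Finset.mem_univ, true_and] at ha hb
  rw [← eq_of_hypergraphDist_le_zero ha, ← eq_of_hypergraphDist_le_zero hb]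

end Graph

/-! ### Gibbs measures and spin flips -/

section Gibbs

variable {N : ℕ}

theorem gibbsWeight_nonneg (H : SpinConfig N → ℝ) (β : ℝ≥0∞) (σ : SpinConfig N) :
    0 ≤ gibbsWeight H β σ := by
  unfold gibbsWeight
  split_ifs <;> positivity

theorem sum_gibbsWeight_pos (H : SpinConfig N → ℝ) (β : ℝ≥0∞) : 0 < ∑ σ, gibbsWeight H β σ := by
  obtain ⟨σ, -, hσ⟩ := Finset.exists_max_image Finset.univ H Finset.univ_nonempty
  refine Finset.sum_pos' (fun σ _ => gibbsWeight_nonneg H β σ) ⟨σ, Finset.mem_univ _, ?_⟩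
  unfold gibbsWeight
  split_ifs with h1 h2
  · exact one_pos
  · exact absurd (fun τ => hσ τ (Finset.mem_univ τ)) h2
  · positivity

theorem gibbs_nonneg (H : SpinConfig N → ℝ) (β : ℝ≥0∞) (σ : SpinConfig N) : 0 ≤ gibbs H β σ :=
  div_nonneg (gibbsWeight_nonneg _ _ _) (sum_gibbsWeight_pos _ _).le

theorem sum_gibbs (H : SpinConfig N → ℝ) (β : ℝ≥0∞) : ∑ σ, gibbs H β σ = 1 := by
  simp only [gibbs]
  rw [← Finset.sum_div, div_self (sum_gibbsWeight_pos H β).ne']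

/-- At β = ∞ this holds because a bijection of configurations carries maximizers to maximizers. -/
theorem gibbsWeight_comp_equiv (H : SpinConfig N → ℝ) (β : ℝ≥0∞)
    (g : SpinConfig N ≃ SpinConfig N) (σ : SpinConfig N) :
    gibbsWeight (H ∘ g) β σ = gibbsWeight H β (g σ) := by
  have h : (∀ τ, H (g τ) ≤ H (g σ)) ↔ ∀ τ, H τ ≤ H (g σ) :=
    g.forall_congr_left.trans (by simp)
  simp [gibbsWeight, h]

theorem gibbs_comp_equiv (H : SpinConfig N → ℝ) (β : ℝ≥0∞)
    (g : SpinConfig N ≃ SpinConfig N) (σ : SpinConfig N) :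
    gibbs (H ∘ g) β σ = gibbs H β (g σ) := by
  simp only [gibbs, gibbsWeight_comp_equiv]
  rw [g.sum_comp fun τ => gibbsWeight H β τ]

theorem abs_spin (σ : SpinConfig N) (i : Fin N) : |spin σ i| = 1 := by
  rcases Int.units_eq_one_or (σ i) with h | h <;> simp [spin, h]

/-- Flip the spins in `V`. -/
def flipSpins (V : Finset (Fin N)) : SpinConfig N ≃ SpinConfig N :=
  Function.Involutive.toPerm (fun σ i => if i ∈ V then -σ i else σ i) fun σ => by
    ext i; by_cases h : i ∈ V <;> simp [h]

theorem spin_flipSpins (V : Finset (Fin N)) (σ : SpinConfig N) (i : Fin N) :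
    spin (flipSpins V σ) i = (if i ∈ V then -1 else 1) * spin σ i := by
  have hf : flipSpins V σ i = if i ∈ V then -σ i else σ i := rfl
  by_cases h : i ∈ V <;> simp [hf, spin, h]

theorem prod_spin_flipSpins (V a : Finset (Fin N)) (σ : SpinConfig N) :
    ∏ i ∈ a, spin (flipSpins V σ) i = (-1) ^ (a ∩ V).card * ∏ i ∈ a, spin σ i := by
  simp_rw [spin_flipSpins, Finset.prod_mul_distrib]
  congr 1
  rw [Finset.prod_ite, Finset.prod_const, Finset.prod_const_one, mul_one, Finset.filter_mem_eq_inter]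

end Gibbs

/-! ### Two-point functions and their gauge symmetry -/

namespace MixedEvenModel

variable {N Δ : ℕ} (M : MixedEvenModel N Δ)

/-- The two-point function `⟨σᵢ σⱼ⟩` of the Gibbs measure with disorder `J`. -/
noncomputable def twoPoint (β : ℝ≥0∞) (i j : Fin N) (J : M.Disorder) : ℝ :=
  ∑ σ, gibbs (M.hamiltonian J) β σ * (spin σ i * spin σ j)

theorem abs_twoPoint_le_one (β : ℝ≥0∞) (i j : Fin N) (J : M.Disorder) :
    |M.twoPoint β i j J| ≤ 1 := by
  refine (Finset.abs_sum_le_sum_abs _ _).trans ?_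
  simp only [abs_mul, abs_spin, mul_one, abs_of_nonneg (gibbs_nonneg _ _ _), sum_gibbs, le_refl]

theorem measurable_hamiltonian (σ : SpinConfig N) : Measurable fun J => M.hamiltonian J σ := by
  unfold hamiltonian
  refine Finset.univ.measurable_sum fun e _ => Measurable.mul_const ?_ _
  exact (M.measurable_ρ _ (M.two_le_card _ e.2) (M.card_le _ e.2)).comp (measurable_pi_apply e)

theorem measurable_gibbsWeight (β : ℝ≥0∞) (σ : SpinConfig N) :
    Measurable fun J => gibbsWeight (M.hamiltonian J) β σ := by
  unfold gibbsWeight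
  by_cases h : β = ⊤
  · simp only [h, if_true]
    refine Measurable.ite ?_ measurable_const measurable_const
    rw [Set.ofPred_forall]
    exact MeasurableSet.iInter fun τ =>
      measurableSet_le (M.measurable_hamiltonian τ) (M.measurable_hamiltonian σ)
  · simp only [h, if_false]
    exact ((M.measurable_hamiltonian σ).const_mul _).exp

theorem measurable_twoPoint (β : ℝ≥0∞) (i j : Fin N) : Measurable (M.twoPoint β i j) := by
  refine Finset.univ.measurable_sum fun σ _ => Measurable.mul_const ?_ _
  exact (M.measurable_gibbsWeight β σ).div
    (Finset.univ.measurable_sum fun τ _ => M.measurable_gibbsWeight β τ)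

/-- Gauge symmetry: flipping the spins in `V` amounts to flipping the disorder at the hyperedges
that meet `V` in an odd number of sites. -/
theorem hamiltonian_gauge (V : Finset (Fin N)) (J : M.Disorder) (σ : SpinConfig N) :
    M.hamiltonian (fun e => if Odd (e.1 ∩ V).card then -J e else J e) (flipSpins V σ)
      = M.hamiltonian J σ := by
  unfold hamiltonian
  refine Finset.sum_congr rfl fun e _ => ?_
  rw [prod_spin_flipSpins]
  beta_reduce
  by_cases h : Odd (e.1 ∩ V).card
  · rw [if_pos h, M.odd_ρ _ (M.two_le_card _ e.2) (M.card_le _ e.2), h.neg_one_pow]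
    ring
  · rw [if_neg h, (Nat.not_odd_iff_even.1 h).neg_one_pow, one_mul]

/-- Substituting the flipped configuration in the Gibbs sum restores the original Hamiltonian, and
exactly one of the spins at i and j changes sign. -/
theorem twoPoint_gauge (β : ℝ≥0∞) {V : Finset (Fin N)} {i j : Fin N} (hi : i ∈ V) (hj : j ∉ V)
    (J : M.Disorder) :
    M.twoPoint β i j (fun e => if Odd (e.1 ∩ V).card then -J e else J e)
      = -M.twoPoint β i j J := by
  unfold twoPoint
  rw [← (flipSpins V).sum_comp, ← Finset.sum_neg_distrib]
  refine Finset.sum_congr rfl fun σ _ => ?_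
  rw [← gibbs_comp_equiv, spin_flipSpins, spin_flipSpins, if_pos hi, if_neg hj]
  have : M.hamiltonian (fun e => if Odd (e.1 ∩ V).card then -J e else J e) ∘ flipSpins V
      = M.hamiltonian J := funext fun σ => M.hamiltonian_gauge V J σ
  rw [this]
  ring

/-- T consists of the hyperedges that meet a separating V in an odd number of sites. Those in S meet
V in nothing or in all their vertices, an even number either way; this is where even hyperedge sizes
enter. -/
theorem exists_flip_twoPoint (β : ℝ≥0∞) {i j : Fin N} {r : ℕ}
    (hd : ¬ hypergraphDist M.edges i j ≤ r) (S : Finset {e // e ∈ M.edges}) (hS : S.card < r + 1) :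
    ∃ T : Finset {e // e ∈ M.edges}, Disjoint S T ∧
      ∀ J, M.twoPoint β i j (fun e => if e ∈ T then -J e else J e) = -M.twoPoint β i j J := by
  obtain ⟨V, hi, hj, hV⟩ := exists_separating (S := S.map (Function.Embedding.subtype _)) hd
    (fun a ha => by
      obtain ⟨e, -, rfl⟩ := Finset.mem_map.1 ha
      exact e.2)
    (by rw [Finset.card_map]; omega)
  refine ⟨Finset.univ.filter fun e => Odd (e.1 ∩ V).card, ?_, fun J => ?_⟩
  · refine Finset.disjoint_left.2 fun e he heT => ?_
    have hodd := (Finset.mem_filter.1 heT).2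
    rcases hV e.1 (Finset.mem_map_of_mem _ he) with h | h
    · rw [Finset.disjoint_iff_inter_eq_empty.1 h] at hodd
      simp at hodd
    · rw [Finset.inter_eq_left.2 h] at hodd
      exact Nat.not_odd_iff_even.2 (M.even_card _ e.2) hodd
  · rw [← M.twoPoint_gauge β hi hj J]
    simp

/-- The two replicas are independent given the disorder, so ⟨σᵢτᵢσⱼτⱼ⟩ factorizes. -/
theorem overlapSqAvg_eq (β : ℝ≥0∞) (J J₂ : M.Disorder) :
    M.overlapSqAvg β J J₂
      = (1 / (N : ℝ)) ^ 2 * ∑ i, ∑ j, M.twoPoint β i j J * M.twoPoint β i j J₂ := by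
  have h : ∀ i j, M.twoPoint β i j J * M.twoPoint β i j J₂
      = ∑ σ, ∑ τ, gibbs (M.hamiltonian J) β σ * gibbs (M.hamiltonian J₂) β τ *
        ((spin σ i * spin τ i) * (spin σ j * spin τ j)) := fun i j => by
    rw [twoPoint, twoPoint, Finset.sum_mul_sum]
    exact Finset.sum_congr rfl fun σ _ => Finset.sum_congr rfl fun τ _ => by ring
  have hR : ∀ σ τ : SpinConfig N, overlap σ τ ^ 2
      = (1 / (N : ℝ)) ^ 2 * ∑ i, ∑ j, (spin σ i * spin τ i) * (spin σ j * spin τ j) :=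
    fun σ τ => by rw [overlap, mul_pow, sq (∑ i, _), Finset.sum_mul_sum]
  simp_rw [h]
  calc _ = (1 / (N : ℝ)) ^ 2 * ∑ σ, ∑ τ, ∑ i, ∑ j, gibbs (M.hamiltonian J) β σ *
        gibbs (M.hamiltonian J₂) β τ * ((spin σ i * spin τ i) * (spin σ j * spin τ j)) := by
        rw [overlapSqAvg, Finset.mul_sum]
        refine Finset.sum_congr rfl fun σ _ => ?_
        rw [Finset.mul_sum]
        refine Finset.sum_congr rfl fun τ _ => ?_
        rw [hR]
        simp only [← Finset.mul_sum]
        ring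
    _ = _ := by
        congr 1
        rw [Finset.sum_congr rfl fun σ _ => Finset.sum_comm, Finset.sum_comm]
        refine Finset.sum_congr rfl fun i _ => ?_
        rw [Finset.sum_congr rfl fun σ _ => Finset.sum_comm, Finset.sum_comm]

theorem measurable_perturbed (P : Perturbation) (t : ℝ≥0) : Measurable (M.perturbed P t) :=
  measurable_pi_lambda _ fun e => (measurable_perturbCoord P t).comp
    (f := fun ω : M.Disorder × M.Disorder × M.Disorder => (ω.1 e, ω.2.1 e, ω.2.2 e)) (by fun_prop)

theorem integral_noiseLaw (P : Perturbation) (t : ℝ≥0) {f : M.Disorder → ℝ} (hf : Measurable f) :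
    ∫ ω, f ω.1 * f (M.perturbed P t ω) ∂M.noiseLaw t = correlation (pairLaw P t) f := by
  have hmp := (MeasurePreserving.id (Measure.pi fun _ : {e // e ∈ M.edges} => gaussianReal 0 1)).prod
    (measurePreserving_arrowProdEquivProdArrow ℝ ℝ {e // e ∈ M.edges}
      (fun _ => gaussianReal 0 1) (fun _ => bernoulliMeasure (1 : ℝ) 0 (keepProb t)))
  have hG : Measurable fun ω : M.Disorder × M.Disorder × M.Disorder =>
      f ω.1 * f (M.perturbed P t ω) :=
    (hf.comp measurable_fst).mul (hf.comp (M.measurable_perturbed P t))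
  rw [pairLaw, correlation_map _ (measurable_fst.prodMk (measurable_perturbCoord P t)) hf,
    noiseLaw, ← hmp.map_eq, integral_map hmp.measurable.aemeasurable hG.aestronglyMeasurable]
  exact (integral_pi_prod (gaussianReal 0 1) (coordNoise t)
    fun p => f p.1 * f fun e => perturbCoord P t (p.1 e, p.2 e)).symm

theorem integrable_twoPoint_mul (P : Perturbation) (t : ℝ≥0) (β : ℝ≥0∞) (i j : Fin N) :
    Integrable (fun ω => M.twoPoint β i j ω.1 * M.twoPoint β i j (M.perturbed P t ω))
      (M.noiseLaw t) := by
  have : IsProbabilityMeasure (M.noiseLaw t) := by unfold noiseLaw; infer_instance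
  have hpm := M.measurable_perturbed P t
  refine .of_bound (((M.measurable_twoPoint β i j).comp measurable_fst).mul
    ((M.measurable_twoPoint β i j).comp hpm)).aestronglyMeasurable 1 (ae_of_all _ fun ω => ?_)
  rw [norm_mul]
  exact mul_le_one₀ (M.abs_twoPoint_le_one _ _ _ _) (norm_nonneg _) (M.abs_twoPoint_le_one _ _ _ _)

theorem integrable_overlapSqAt (P : Perturbation) (t : ℝ≥0) (β : ℝ≥0∞) :
    Integrable (M.overlapSqAt P β t) (M.noiseLaw t) := by
  unfold overlapSqAt
  simp_rw [overlapSqAvg_eq]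
  exact (integrable_finsetSum _ fun i _ => integrable_finsetSum _ fun j _ =>
    M.integrable_twoPoint_mul P t β i j).const_mul _

theorem expectedOverlapSq_eq (P : Perturbation) (t : ℝ≥0) (β : ℝ≥0∞) :
    M.expectedOverlapSq P β t
      = (1 / (N : ℝ)) ^ 2 * ∑ i, ∑ j, correlation (pairLaw P t) (M.twoPoint β i j) := by
  unfold expectedOverlapSq overlapSqAt
  simp_rw [overlapSqAvg_eq]
  rw [integral_const_mul, integral_finsetSum _ fun i _ => integrable_finsetSum _ fun j _ =>
    M.integrable_twoPoint_mul P t β i j]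
  congr 1
  refine Finset.sum_congr rfl fun i _ => ?_
  rw [integral_finsetSum _ fun j _ => M.integrable_twoPoint_mul P t β i j]
  exact Finset.sum_congr rfl fun j _ => M.integral_noiseLaw P t (M.measurable_twoPoint β i j)

theorem correlation_twoPoint_le_one (P : Perturbation) (t : ℝ≥0) (β : ℝ≥0∞) (i j : Fin N) :
    correlation (pairLaw P t) (M.twoPoint β i j) ≤ 1 :=
  (le_abs_self _).trans (abs_correlation_le_one _ (M.abs_twoPoint_le_one β i j))

theorem correlation_twoPoint_le_exp (P : Perturbation) (t : ℝ≥0) (β : ℝ≥0∞) {i j : Fin N} {r : ℕ}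
    (hj : j ∉ hypergraphBall M.edges r i) :
    correlation (pairLaw P t) (M.twoPoint β i j) ≤ Real.exp (-(t * (r + 1))) := by
  classical
  have hd : ¬ hypergraphDist M.edges i j ≤ r := fun h => hj (by simp [hypergraphBall, h])
  exact_mod_cast correlation_pairLaw_le P (M.measurable_twoPoint β i j)
    (M.abs_twoPoint_le_one β i j) (M.exists_flip_twoPoint β hd) t

end MixedEvenModel

/-! ### Summation over pairs of sites -/

namespace MixedEvenModel

variable {N Δ : ℕ} (M : MixedEvenModel N Δ)

theorem sum_ite_mem_hypergraphBall_le (r : ℕ) (i : Fin N) {c : ℝ} (hc : 0 ≤ c) :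
    ∑ j, (if j ∈ hypergraphBall M.edges r i then c else 0) ≤ maxBallCard M.edges r * c := by
  rw [← Finset.sum_filter, Finset.sum_const, nsmul_eq_mul, Finset.filter_mem_eq_inter,
    Finset.univ_inter]
  gcongr
  exact card_hypergraphBall_le_maxBallCard _ _ _

theorem average_sum_le (hN : 1 ≤ N) {c : ℝ} {F : Fin N → ℝ} (hF : ∀ i, F i ≤ c) :
    (1 / (N : ℝ)) ^ 2 * ∑ i, F i ≤ 1 / N * c := by
  have hN' : (0 : ℝ) < N := by exact_mod_cast hN
  calc _ ≤ (1 / (N : ℝ)) ^ 2 * (N * c) := by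
        gcongr
        exact (Finset.sum_le_card_nsmul _ _ c fun i _ => hF i).trans (by simp)
    _ = 1 / N * c := by field_simp

theorem expectedOverlapSq_le (hN : 1 ≤ N) (P : Perturbation) (t : ℝ≥0) (β : ℝ≥0∞) (r : ℕ) :
    M.expectedOverlapSq P β t
      ≤ 1 / (N : ℝ) * maxBallCard M.edges r + Real.exp (-((t : ℝ) * (r + 1))) := by
  have hN' : (0 : ℝ) < N := by exact_mod_cast hN
  rw [expectedOverlapSq_eq]
  refine (average_sum_le hN (c := maxBallCard M.edges r + N * Real.exp (-((t : ℝ) * (r + 1))))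
    fun i => ?_).trans (le_of_eq (by field_simp))
  calc _ ≤ ∑ j, ((if j ∈ hypergraphBall M.edges r i then 1 else 0)
        + Real.exp (-((t : ℝ) * (r + 1)))) := by
        refine Finset.sum_le_sum fun j _ => ?_
        split_ifs with h
        · linarith [M.correlation_twoPoint_le_one P t β i j, Real.exp_pos (-((t : ℝ) * (r + 1)))]
        · linarith [M.correlation_twoPoint_le_exp P t β h]
    _ ≤ _ := by
        rw [Finset.sum_add_distrib]
        have := M.sum_ite_mem_hypergraphBall_le r i zero_le_one
        simpa using this

/-- Layer-cake form of the decay: with a = e^{-t}, aⁿ is the sum of a^r - a^{r+1} over r ≥ n, and r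
≥ n means that the ball of radius r contains j if n is the distance. Truncation at R leaves the
remainder a^{R+1}. -/
theorem correlation_twoPoint_le_sum (P : Perturbation) (t : ℝ≥0) (β : ℝ≥0∞) {i j : Fin N}
    (hij : i ≠ j) (R : ℕ) :
    correlation (pairLaw P t) (M.twoPoint β i j)
      ≤ ∑ r ∈ Finset.range R, (if j ∈ hypergraphBall M.edges (r + 1) i then
          Real.exp (-(t : ℝ)) ^ (r + 1) - Real.exp (-(t : ℝ)) ^ (r + 2) else 0)
        + Real.exp (-(t : ℝ)) ^ (R + 1) := by
  have hexp : ∀ n : ℕ, Real.exp (-(t : ℝ)) ^ (n + 1) = Real.exp (-((t : ℝ) * (n + 1))) := fun n => by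
    rw [← Real.exp_nat_mul]; push_cast; ring_nf
  have ha1 : Real.exp (-(t : ℝ)) ≤ 1 := Real.exp_le_one_iff.2 (by simp)
  have hnn : ∀ n : ℕ, 0 ≤ Real.exp (-(t : ℝ)) ^ (n + 1) - Real.exp (-(t : ℝ)) ^ (n + 2) := fun n =>
    sub_nonneg.2 (pow_le_pow_of_le_one (Real.exp_pos _).le ha1 (by omega))
  induction R with
  | zero =>
    have h : j ∉ hypergraphBall M.edges 0 i := fun h => hij <| by
      classical
      exact eq_of_hypergraphDist_le_zero (Finset.mem_filter.1 h).2
    simpa using M.correlation_twoPoint_le_exp P t β h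
  | succ R ih =>
    rw [Finset.sum_range_succ]
    by_cases h : j ∈ hypergraphBall M.edges (R + 1) i
    · rw [if_pos h]
      linarith
    · have h1 := M.correlation_twoPoint_le_exp P t β h
      rw [← hexp (R + 1)] at h1
      refine h1.trans ?_
      rw [if_neg h, add_zero]
      refine le_add_of_nonneg_left (Finset.sum_nonneg fun r _ => ?_)
      split_ifs
      exacts [hnn r, le_rfl]

/-- Summing the layers over j turns indicators into ball sizes. The diagonal is kept apart so that
it contributes exactly 1/N. -/
theorem expectedOverlapSq_le_sum (hN : 1 ≤ N) (P : Perturbation) (t : ℝ≥0) (β : ℝ≥0∞) (R : ℕ) :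
    M.expectedOverlapSq P β t
      ≤ 1 / (N : ℝ) * (1 + ∑ r ∈ Finset.range R, maxBallCard M.edges (r + 1) *
          (Real.exp (-(t : ℝ)) ^ (r + 1) - Real.exp (-(t : ℝ)) ^ (r + 2)))
        + Real.exp (-(t : ℝ)) ^ (R + 1) := by
  have hN' : (0 : ℝ) < N := by exact_mod_cast hN
  have ha1 : Real.exp (-(t : ℝ)) ≤ 1 := Real.exp_le_one_iff.2 (by simp)
  have hnn : ∀ n : ℕ, 0 ≤ Real.exp (-(t : ℝ)) ^ (n + 1) - Real.exp (-(t : ℝ)) ^ (n + 2) := fun n =>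
    sub_nonneg.2 (pow_le_pow_of_le_one (Real.exp_pos _).le ha1 (by omega))
  rw [expectedOverlapSq_eq]
  refine (average_sum_le hN (c := 1 + ∑ r ∈ Finset.range R, maxBallCard M.edges (r + 1) *
          (Real.exp (-(t : ℝ)) ^ (r + 1) - Real.exp (-(t : ℝ)) ^ (r + 2))
        + N * Real.exp (-(t : ℝ)) ^ (R + 1)) fun i => ?_).trans (le_of_eq (by field_simp))
  calc _ ≤ ∑ j, ((if i = j then 1 else 0) + ∑ r ∈ Finset.range R,
          (if j ∈ hypergraphBall M.edges (r + 1) i then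
          Real.exp (-(t : ℝ)) ^ (r + 1) - Real.exp (-(t : ℝ)) ^ (r + 2) else 0)
        + Real.exp (-(t : ℝ)) ^ (R + 1)) := by
        refine Finset.sum_le_sum fun j _ => ?_
        split_ifs with h
        · have h1 : 0 ≤ ∑ r ∈ Finset.range R, (if j ∈ hypergraphBall M.edges (r + 1) i then
              Real.exp (-(t : ℝ)) ^ (r + 1) - Real.exp (-(t : ℝ)) ^ (r + 2) else 0) :=
            Finset.sum_nonneg fun r _ => by
              split_ifs
              exacts [hnn r, le_rfl]
          have h2 : 0 ≤ Real.exp (-(t : ℝ)) ^ (R + 1) := by positivity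
          linarith [M.correlation_twoPoint_le_one P t β i j]
        · rw [zero_add]
          exact M.correlation_twoPoint_le_sum P t β h R
    _ ≤ _ := by
        rw [Finset.sum_add_distrib, Finset.sum_add_distrib, Finset.sum_comm]
        simp only [Finset.sum_ite_eq, Finset.mem_univ, if_true, Finset.sum_const, Finset.card_univ,
          Fintype.card_fin, nsmul_eq_mul]
        gcongr with r
        exact M.sum_ite_mem_hypergraphBall_le (r + 1) i (hnn r)

end MixedEvenModel

/-! ### Polynomial and exponential growth of balls -/

/-- With q = e^{-t/2}, half of the decay, qⁿ, absorbs n^θ at the cost (2θ/t)^θ, and the other half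
still telescopes in n. The 2 comes from 1 - q² = (1 + q)(1 - q). -/
theorem rpow_mul_exp_neg_pow_sub_le {θ t : ℝ} (hθ : 0 < θ) (ht : 0 < t) (n : ℕ) :
    (n : ℝ) ^ θ * (Real.exp (-t) ^ n - Real.exp (-t) ^ (n + 1))
      ≤ 2 * (2 * θ) ^ θ / t ^ θ * (Real.exp (-(t / 2)) ^ n - Real.exp (-(t / 2)) ^ (n + 1)) := by
  have hq : Real.exp (-t) = Real.exp (-(t / 2)) ^ 2 := by
    rw [← Real.exp_nat_mul]; push_cast; ring_nf
  rw [hq]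
  set q := Real.exp (-(t / 2)) with hqdef
  have hq0 : 0 < q := Real.exp_pos _
  have hq1 : q ≤ 1 := Real.exp_le_one_iff.2 (by linarith)
  have hn : (n : ℝ) ^ θ * q ^ n ≤ (2 * θ) ^ θ / t ^ θ := by
    rw [le_div_iff₀ (by positivity)]
    -- The scale 2θ is chosen so that the θ-th power of the exponential is e^{tn/2}, the inverse of
    -- qⁿ.
    have h1 : t * n ≤ 2 * θ * Real.exp (t * n / (2 * θ)) := by
      have := Real.add_one_le_exp (t * n / (2 * θ))
      rw [← div_le_iff₀' (by positivity)]
      linarith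
    have h2 : (t * n) ^ θ ≤ (2 * θ) ^ θ * Real.exp (t * n / 2) := by
      refine (Real.rpow_le_rpow (by positivity) h1 hθ.le).trans (le_of_eq ?_)
      rw [Real.mul_rpow (by positivity) (by positivity), ← Real.exp_mul]
      congr 2
      field_simp
    have h3 : q ^ n * Real.exp (t * n / 2) = 1 := by
      rw [hqdef, ← Real.exp_nat_mul, ← Real.exp_add, Real.exp_eq_one_iff]
      ring
    calc (n : ℝ) ^ θ * q ^ n * t ^ θ = q ^ n * (t * n) ^ θ := by
          rw [Real.mul_rpow ht.le (by positivity)]; ring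
      _ ≤ q ^ n * ((2 * θ) ^ θ * Real.exp (t * n / 2)) := by gcongr
      _ = (2 * θ) ^ θ := by rw [mul_left_comm, h3, mul_one]
  calc (n : ℝ) ^ θ * ((q ^ 2) ^ n - (q ^ 2) ^ (n + 1))
      = (n : ℝ) ^ θ * q ^ n * (1 + q) * (q ^ n - q ^ (n + 1)) := by ring
    _ ≤ (2 * θ) ^ θ / t ^ θ * 2 * (q ^ n - q ^ (n + 1)) := by
        have : 0 ≤ q ^ n - q ^ (n + 1) :=
          sub_nonneg.2 (pow_le_pow_of_le_one hq0.le hq1 (Nat.le_succ n))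
        gcongr
        linarith
    _ = _ := by ring

namespace MixedEvenModel

variable {N Δ : ℕ} (M : MixedEvenModel N Δ)

theorem expectedOverlapSq_le_of_polynomial_growth (hN : 1 ≤ N) {A θ : ℝ} (hA : 0 < A) (hθ : 0 < θ)
    (hball : ∀ r : ℕ, 1 ≤ r → (maxBallCard M.edges r : ℝ) ≤ A * (r : ℝ) ^ θ) (P : Perturbation)
    {t : ℝ≥0} (ht : 0 < t) (β : ℝ≥0∞) :
    M.expectedOverlapSq P β t
      ≤ 1 / (N : ℝ) + A * (2 * (2 * θ) ^ θ) / ((N : ℝ) * (t : ℝ) ^ θ) := by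
  have hN' : (0 : ℝ) < N := by exact_mod_cast hN
  have ht' : (0 : ℝ) < t := ht
  have ha1 : Real.exp (-(t : ℝ)) < 1 := Real.exp_lt_one_iff.2 (by linarith)
  -- The layer sum is bounded uniformly in R, so the truncation error disappears as R tends to
  -- infinity.
  have hlim : Filter.Tendsto (fun R : ℕ => 1 / (N : ℝ) + A * (2 * (2 * θ) ^ θ) /
      ((N : ℝ) * (t : ℝ) ^ θ) + Real.exp (-(t : ℝ)) ^ (R + 1)) Filter.atTop
      (nhds (1 / (N : ℝ) + A * (2 * (2 * θ) ^ θ) / ((N : ℝ) * (t : ℝ) ^ θ) + 0)) :=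
    ((tendsto_pow_atTop_nhds_zero_of_lt_one (Real.exp_pos _).le ha1).comp
      (Filter.tendsto_add_atTop_nat 1)).const_add _
  rw [add_zero] at hlim
  refine ge_of_tendsto' hlim fun R => (M.expectedOverlapSq_le_sum hN P t β R).trans ?_
  set q := Real.exp (-((t : ℝ) / 2)) with hq
  have hq0 : 0 < q := Real.exp_pos _
  have hq1 : q ≤ 1 := Real.exp_le_one_iff.2 (by linarith)
  have hsum : ∑ r ∈ Finset.range R, maxBallCard M.edges (r + 1) *
      (Real.exp (-(t : ℝ)) ^ (r + 1) - Real.exp (-(t : ℝ)) ^ (r + 2))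
      ≤ A * (2 * (2 * θ) ^ θ / (t : ℝ) ^ θ) := by
    calc _ ≤ ∑ r ∈ Finset.range R, A * (2 * (2 * θ) ^ θ / (t : ℝ) ^ θ) *
          (q ^ (r + 1) - q ^ (r + 1 + 1)) := by
          refine Finset.sum_le_sum fun r _ => ?_
          have h1 := hball (r + 1) (by omega)
          have h2 := rpow_mul_exp_neg_pow_sub_le hθ ht' (r + 1)
          have h3 : 0 ≤ Real.exp (-(t : ℝ)) ^ (r + 1) - Real.exp (-(t : ℝ)) ^ (r + 2) :=
            sub_nonneg.2 (pow_le_pow_of_le_one (Real.exp_pos _).le ha1.le (by omega))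
          refine (mul_le_mul_of_nonneg_right h1 h3).trans ?_
          rw [mul_assoc, mul_assoc]
          exact mul_le_mul_of_nonneg_left h2 hA.le
      _ = A * (2 * (2 * θ) ^ θ / (t : ℝ) ^ θ) * (q ^ (0 + 1) - q ^ (R + 1)) := by
          rw [← Finset.mul_sum, Finset.sum_range_sub' (fun r => q ^ (r + 1))]
      _ ≤ A * (2 * (2 * θ) ^ θ / (t : ℝ) ^ θ) * 1 := by
          gcongr
          have : 0 < q ^ (R + 1) := by positivity
          rw [zero_add, pow_one]
          linarith
      _ = _ := mul_one _
  calc _ ≤ 1 / (N : ℝ) * (1 + A * (2 * (2 * θ) ^ θ / (t : ℝ) ^ θ))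
        + Real.exp (-(t : ℝ)) ^ (R + 1) := by gcongr
    _ = _ := by
        have : (t : ℝ) ^ θ ≠ 0 := by positivity
        field_simp

theorem expectedOverlapSq_le_of_exponential_growth (hN : 1 ≤ N) {A γ : ℝ} (hγ : 1 < γ)
    (hball : ∀ r : ℕ, 1 ≤ r → (maxBallCard M.edges r : ℝ) ≤ A * γ ^ r) (P : Perturbation)
    (t : ℝ≥0) (β : ℝ≥0∞) :
    M.expectedOverlapSq P β t
      ≤ (max A 1 + 1) / (N : ℝ) ^ ((t : ℝ) / ((t : ℝ) + Real.log γ)) := by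
  have hN' : (0 : ℝ) < N := by exact_mod_cast hN
  have hlog : 0 < Real.log γ := Real.log_pos hγ
  have hden : 0 < (t : ℝ) + Real.log γ := add_pos_of_nonneg_of_pos t.coe_nonneg hlog
  -- This x balances the two error terms: γ^x / N = e^{-xt}. The radius used is ⌊x⌋.
  set x := Real.log N / ((t : ℝ) + Real.log γ) with hx
  have hx0 : 0 ≤ x := div_nonneg (Real.log_nonneg (by exact_mod_cast hN)) hden.le
  have hxlog : Real.log N = x * ((t : ℝ) + Real.log γ) := by rw [hx]; field_simp
  have hNx : (N : ℝ) = Real.exp (x * t + x * Real.log γ) := by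
    rw [← mul_add, ← hxlog, Real.exp_log hN']
  have hpow : (N : ℝ) ^ ((t : ℝ) / ((t : ℝ) + Real.log γ)) = Real.exp (x * t) := by
    rw [Real.rpow_def_of_pos hN', hxlog]
    congr 1
    field_simp
  -- The radius ⌊x⌋ may be 0, where the growth hypothesis says nothing; `max A 1` covers that case.
  have hball' : ∀ r : ℕ, (maxBallCard M.edges r : ℝ) ≤ max A 1 * γ ^ r := fun r => by
    rcases Nat.eq_zero_or_pos r with rfl | hr
    · have : (maxBallCard M.edges 0 : ℝ) ≤ 1 := by exact_mod_cast maxBallCard_zero_le M.edges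
      simpa using this.trans (le_max_right A 1)
    · exact (hball r hr).trans (by gcongr; exact le_max_left _ _)
  have hfl : (⌊x⌋₊ : ℝ) ≤ x := Nat.floor_le hx0
  have hfl' : x ≤ ⌊x⌋₊ + 1 := (Nat.lt_floor_add_one x).le
  have hγr : γ ^ ⌊x⌋₊ ≤ Real.exp (x * Real.log γ) := by
    rw [← Real.exp_log (show (0 : ℝ) < γ by linarith), ← Real.exp_nat_mul, Real.log_exp]
    gcongr
  rw [hpow, div_eq_mul_inv, ← Real.exp_neg]
  refine (M.expectedOverlapSq_le hN P t β ⌊x⌋₊).trans ?_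
  rw [add_mul, one_mul]
  refine add_le_add ?_ ?_
  · calc _ ≤ 1 / (N : ℝ) * (max A 1 * Real.exp (x * Real.log γ)) := by
          gcongr
          exact (hball' _).trans (by gcongr)
      _ = max A 1 * Real.exp (-(x * t)) := by
          rw [hNx, one_div, ← Real.exp_neg, mul_left_comm, ← Real.exp_add]
          congr 2
          ring
  -- The decay exponent r + 1, rather than r, pays for rounding down: ⌊x⌋ + 1 ≥ x.
  · rw [mul_comm x]
    gcongr

end MixedEvenModel

theorem theorem1 :
    (∀ (N Δ : ℕ), 1 ≤ N → 2 ≤ Δ → ∀ (M : MixedEvenModel N Δ) (P : Perturbation)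
      (t : ℝ≥0) (β : ℝ≥0∞),
        Integrable (M.overlapSqAt P β t) (M.noiseLaw t) ∧
        ∀ r : ℕ, M.expectedOverlapSq P β t
          ≤ (1 / (N : ℝ)) * (maxBallCard M.edges r : ℝ) + Real.exp (-((t : ℝ) * (r : ℝ)))) ∧
    (∀ A θ : ℝ, 0 < A → 0 < θ → ∃ C : ℝ, 0 < C ∧
      ∀ (N Δ : ℕ), 1 ≤ N → 2 ≤ Δ → ∀ M : MixedEvenModel N Δ,
        (∀ r : ℕ, 1 ≤ r → (maxBallCard M.edges r : ℝ) ≤ A * (r : ℝ) ^ θ) →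
        ∀ (P : Perturbation) (t : ℝ≥0) (β : ℝ≥0∞), 0 < t →
          M.expectedOverlapSq P β t ≤ 1 / (N : ℝ) + C / ((N : ℝ) * (t : ℝ) ^ θ)) ∧
    (∀ A γ : ℝ, 1 < γ → ∃ C : ℝ, 0 < C ∧
      ∀ (N Δ : ℕ), 1 ≤ N → 2 ≤ Δ → ∀ M : MixedEvenModel N Δ,
        (∀ r : ℕ, 1 ≤ r → (maxBallCard M.edges r : ℝ) ≤ A * γ ^ r) →
        ∀ (P : Perturbation) (t : ℝ≥0) (β : ℝ≥0∞), 0 < t →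
          M.expectedOverlapSq P β t
            ≤ C / (N : ℝ) ^ ((t : ℝ) / ((t : ℝ) + Real.log γ))) := by
  refine ⟨fun N Δ hN _ M P t β => ⟨M.integrable_overlapSqAt P t β, fun r => ?_⟩,
    fun A θ hA hθ => ⟨A * (2 * (2 * θ) ^ θ), by positivity, fun N Δ hN _ M hball P t β ht =>
      M.expectedOverlapSq_le_of_polynomial_growth hN hA hθ hball P ht β⟩,
    fun A γ hγ => ⟨max A 1 + 1, by positivity, fun N Δ hN _ M hball P t β _ =>
      M.expectedOverlapSq_le_of_exponential_growth hN hγ hball P t β⟩⟩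
  refine (M.expectedOverlapSq_le hN P t β r).trans ?_
  have := t.coe_nonneg
  gcongr
  linarith
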